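/- Let $M$ be a smooth manifold of dimension $n\ge 3$ and let $\tau:T^\circ M\to M$ be its slit tangent bundle (the tangent bundle without the zero section), with Liouville field $\Delta=y^i\,\partial/\partial y^i$. A *spray* is a smooth vector field $\Gamma$ on $T^\circ M$ with $\tau_*\Gamma_{(x,y)}=y$ and $[\Delta,\Gamma]=\Gamma$; locally $\Gamma=y^i\frac{\partial}{\partial x^i}-2\Gamma^i\frac{\partial}{\partial y^i}$, and its horizontal distribution is spanned by $H_i=\frac{\partial}{\partial x^i}-\frac{\partial\Gamma^j}{\partial y^i}\frac{\partial}{\partial y^j}$. Its geodesics are its base integral curves. Two sprays are projectively equivalent if their geodesics are the same up to orientation-preserving reparametrization; the equivalence classes are the projective classes. Let $\mathcal D$ be the distribution on $T^\circ M$ spanned by $\Delta$ and any spray of the class. Over an open set $U\subset M$, a *pseudo-Finsler function* is a smooth function $F$ on $\tau^{-1}U$, positively homogeneous of degree $1$ in $y$, such that $\frac{\partial^2F}{\partial y^i\partial y^j}v^j=0$ if and only if $v$ is a scalar multiple of $y$. Its *geodesic class* is the set of sprays over $U$ whose geodesics all satisfy the Euler–Lagrange equations of $F$. Let a projective class of sprays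 on $M$ be given, let $U\subset M$ be the domain of a chart, and let $\mathcal P$ be the projective class over $U$ obtained by restricting it to $\tau^{-1}U$. For a spray $\Gamma\in\mathcal P$ and a smooth 2-form $\omega$ on $\tau^{-1}U$ consider the conditions: 1. the characteristic distribution $\{v : i_v\omega=0\}$ of $\omega$ contains $\mathcal D$; 2. $\mathcal L_\Gamma\omega=0$; 3. $\omega(V_1,V_2)=0$ for all vertical vector fields $V_1,V_2$; 4. $d\omega(H,V_1,V_2)=0$ for every horizontal (with respect to $\Gamma$) vector field $H$ and all vertical vector fields $V_1,V_2$. (a) If $\mathcal P$ is the geodesic class of a pseudo-Finsler function over $U$, then there is a smooth 2-form $\omega$ on $\tau^{-1}U$ that satisfies 1–4 for every $\Gamma\in\mathcal P$ and whose characteristic distribution is precisely $\mathcal D$. (b) Conversely, if $U$ is contractible and there is a smooth 2-form $\omega$ on $\tau^{-1}U$ that satisfies 1–4 for some $\Gamma\in\mathcal P$ and whose characteristic distribution is precisely $\mathcal D$, then $\mathcal P$ is the geodesic class of a pseudo-Finsler function over $U$. In particular, over a contractible coordinate neighbourhood $U$ the two conditions are equivalent. -/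

import Mathlib

open Set
open scoped Manifold ContDiff Topology

noncomputable section

namespace SprayGeometry

/-! ### Sprays on a manifold -/

section Global

variable {n : ℕ} {M : Type*} [TopologicalSpace M] [ChartedSpace (EuclideanSpace ℝ (Fin n)) M]

/-- The slit tangent bundle of a manifold: the tangent bundle with the zero section removed. -/
def slitTangentBundle (n : ℕ) (M : Type*) [TopologicalSpace M]
    [ChartedSpace (EuclideanSpace ℝ (Fin n)) M] [IsManifold (𝓡 n) ∞ M] :
    Set (TangentBundle (𝓡 n) M) :=
  {p | p.2 ≠ 0}

/-- The Liouville field on the tangent bundle: its value at `(x, y)` is the velocity at `s = 1` of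
the curve `s ↦ (x, s y)`. -/
def liouville [IsManifold (𝓡 n) ∞ M] (p : TangentBundle (𝓡 n) M) :
    TangentSpace (𝓡 n).tangent p :=
  mfderiv 𝓘(ℝ, ℝ) (𝓡 n).tangent
    (fun s : ℝ => (⟨p.1, s • p.2⟩ : TangentBundle (𝓡 n) M)) 1 (1 : ℝ)

/-- A spray on the manifold `M`: a smooth vector field `Γ` on the slit tangent bundle with
`τ_* Γ = y` at each `(x, y)` and `[Δ, Γ] = Γ`. (Values on the zero section are irrelevant.) -/
structure IsSpray [IsManifold (𝓡 n) ∞ M]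
    (Γ : (p : TangentBundle (𝓡 n) M) → TangentSpace (𝓡 n).tangent p) : Prop where
  smooth : ContMDiffOn (𝓡 n).tangent (𝓡 n).tangent.tangent ∞
    (fun p => (⟨p, Γ p⟩ : TangentBundle (𝓡 n).tangent (TangentBundle (𝓡 n) M)))
    (slitTangentBundle n M)
  second_order : ∀ p ∈ slitTangentBundle n M,
    mfderiv (𝓡 n).tangent (𝓡 n) (fun q : TangentBundle (𝓡 n) M => q.1) p (Γ p) = p.2
  homogeneous : ∀ p ∈ slitTangentBundle n M,
    VectorField.mlieBracket (𝓡 n).tangent liouville Γ p = Γ p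

/-- The natural coordinates `(x, y)` on `TM` over the domain of a chart `φ` of `M`. -/
def inducedChart (φ : OpenPartialHomeomorph M (EuclideanSpace ℝ (Fin n)))
    (p : TangentBundle (𝓡 n) M) : EuclideanSpace ℝ (Fin n) × EuclideanSpace ℝ (Fin n) :=
  (φ p.1, mfderiv (𝓡 n) (𝓡 n) φ p.1 p.2)

/-- The tangent vector to `M` with natural coordinates `(x, y)`. -/
def inducedChartSymm (φ : OpenPartialHomeomorph M (EuclideanSpace ℝ (Fin n)))
    (q : EuclideanSpace ℝ (Fin n) × EuclideanSpace ℝ (Fin n)) : TangentBundle (𝓡 n) M :=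
  ⟨φ.symm q.1, mfderiv (𝓡 n) (𝓡 n) φ.symm q.1 q.2⟩

/-- The expression of a vector field on `TM` in the natural coordinates `(x, y)` of a chart. -/
def localExpression [IsManifold (𝓡 n) ∞ M]
    (φ : OpenPartialHomeomorph M (EuclideanSpace ℝ (Fin n)))
    (Γ : (p : TangentBundle (𝓡 n) M) → TangentSpace (𝓡 n).tangent p)
    (q : EuclideanSpace ℝ (Fin n) × EuclideanSpace ℝ (Fin n)) :
    EuclideanSpace ℝ (Fin n) × EuclideanSpace ℝ (Fin n) :=
  mfderiv (𝓡 n).tangent 𝓘(ℝ, EuclideanSpace ℝ (Fin n) × EuclideanSpace ℝ (Fin n))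
    (inducedChart φ) (inducedChartSymm φ q) (Γ (inducedChartSymm φ q))

end Global

/-! ### Sprays, forms and pseudo-Finsler functions over a coordinate neighbourhood

A coordinate neighbourhood is identified by its chart with an open set `V` of `E = ℝⁿ`, and the part
of the slit tangent bundle over it with `V × (E \ {0})`, with natural coordinates `(x, y)`. -/

section Local

variable {E : Type*} [NormedAddCommGroup E] [NormedSpace ℝ E]

/-- The slit tangent bundle over `V`. -/
def slit (V : Set E) : Set (E × E) := {p | p.1 ∈ V ∧ p.2 ≠ 0}

/-- The Liouville field `Δ = yⁱ ∂/∂yⁱ`. -/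
def Δ (p : E × E) : E × E := (0, p.2)

/-- A spray over `V`: a smooth vector field on the slit tangent bundle over `V` of the form
`Γ = yⁱ ∂/∂xⁱ - 2 Γⁱ ∂/∂yⁱ` with `[Δ, Γ] = Γ`. -/
structure IsSprayOn (V : Set E) (Γ : E × E → E × E) : Prop where
  smooth : ContDiffOn ℝ ∞ Γ (slit V)
  second_order : ∀ p ∈ slit V, (Γ p).1 = p.2
  homogeneous : ∀ p ∈ slit V, VectorField.lieBracket ℝ Δ Γ p = Γ p

/-- The curve `c`, on the open interval `J`, is a geodesic of `Γ`, that is, the projection to the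
base of an integral curve of `Γ` in the slit tangent bundle over `V`. -/
def IsGeodesicOn (V : Set E) (Γ : E × E → E × E) (c : ℝ → E) (J : Set ℝ) : Prop :=
  IsOpen J ∧ J.OrdConnected ∧ ∃ γ : ℝ → E × E,
    ∀ t ∈ J, γ t ∈ slit V ∧ HasDerivAt γ (Γ (γ t)) t ∧ (γ t).1 = c t

/-- Every geodesic of `Γ` becomes a geodesic of `Γ'` after an orientation-preserving
reparametrization. -/
def GeodesicsReparametrize (V : Set E) (Γ Γ' : E × E → E × E) : Prop :=
  ∀ (c : ℝ → E) (J : Set ℝ), IsGeodesicOn V Γ c J →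
    ∃ (σ : ℝ → ℝ) (J' : Set ℝ), BijOn σ J' J ∧ ContDiffOn ℝ ∞ σ J' ∧ (∀ s ∈ J', 0 < deriv σ s) ∧
      IsGeodesicOn V Γ' (c ∘ σ) J'

/-- Projective equivalence: the same geodesics up to orientation-preserving reparametrization. -/
def ProjectivelyEquivalent (V : Set E) (Γ Γ' : E × E → E × E) : Prop :=
  GeodesicsReparametrize V Γ Γ' ∧ GeodesicsReparametrize V Γ' Γ

/-- The projective class, over `V`, of the spray `Γ`. -/
def projectiveClass (V : Set E) (Γ : E × E → E × E) : Set (E × E → E × E) :=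
  {Γ' | IsSprayOn V Γ' ∧ ProjectivelyEquivalent V Γ Γ'}

/-- The second derivative `∂²F/∂yⁱ∂yʲ uⁱ vʲ` of `F` along the fibre. -/
def fibreHessian (F : E × E → ℝ) (p : E × E) (u v : E) : ℝ :=
  fderiv ℝ (fun q => fderiv ℝ F q (0, v)) p (0, u)

/-- A pseudo-Finsler function over `V`: a smooth, positively homogeneous function on the slit
tangent bundle whose fibre Hessian is quasi-regular, that is, `h_{ij}(x, y) vʲ = 0` if and only if
`v` is a scalar multiple of `y`. -/
structure IsPseudoFinsler (V : Set E) (F : E × E → ℝ) : Prop where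
  smooth : ContDiffOn ℝ ∞ F (slit V)
  homogeneous : ∀ p ∈ slit V, ∀ r : ℝ, 0 < r → F (p.1, r • p.2) = r * F p
  quasiRegular : ∀ p ∈ slit V, ∀ v : E,
    (∀ u : E, fibreHessian F p u v = 0) ↔ ∃ k : ℝ, v = k • p.2

/-- The Euler-Lagrange equations `d/dt (∂F/∂yⁱ (c, ċ)) = ∂F/∂xⁱ (c, ċ)` on `J`. -/
def SolvesEulerLagrange (F : E × E → ℝ) (c : ℝ → E) (J : Set ℝ) : Prop :=
  ∀ t ∈ J, ∀ a : E, HasDerivAt (fun s => fderiv ℝ F (c s, deriv c s) (0, a))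
    (fderiv ℝ F (c t, deriv c t) (a, 0)) t

/-- The geodesic class of `F`: all sprays over `V` whose geodesics satisfy the Euler-Lagrange
equations of `F`. -/
def geodesicClass (V : Set E) (F : E × E → ℝ) : Set (E × E → E × E) :=
  {Γ | IsSprayOn V Γ ∧
    ∀ (c : ℝ → E) (J : Set ℝ), IsGeodesicOn V Γ c J → SolvesEulerLagrange F c J}

/-- The distribution `𝒟` spanned by `Δ` and the spray `Γ`. -/
def sprayDistribution (Γ : E × E → E × E) (p : E × E) : Submodule ℝ (E × E) :=
  Submodule.span ℝ {Δ p, Γ p}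

/-- The characteristic distribution of a 2-form: the vectors `v` with `i_v Ω = 0`. -/
def characteristicDistribution (Ω : E × E → (E × E) [⋀^Fin 2]→L[ℝ] ℝ) (p : E × E) :
    Submodule ℝ (E × E) :=
  LinearMap.ker ((Ω p).curryLeft : E × E →ₗ[ℝ] (E × E) [⋀^Fin 1]→L[ℝ] ℝ)

/-- The Lie derivative of a 2-form `Ω` along a vector field `X` on an open set of a vector space:
`(ℒ_X Ω)(u, v) = (D_X Ω)(u, v) + Ω(DX u, v) + Ω(u, DX v)`. -/
def lieDeriv (X : E × E → E × E) (Ω : E × E → (E × E) [⋀^Fin 2]→L[ℝ] ℝ) (p u v : E × E) : ℝ :=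
  fderiv ℝ Ω p (X p) ![u, v] + Ω p ![fderiv ℝ X p u, v] + Ω p ![u, fderiv ℝ X p v]

/-- The components `Γⁱ` in `Γ = yⁱ ∂/∂xⁱ - 2 Γⁱ ∂/∂yⁱ`. -/
def sprayCoeff (Γ : E × E → E × E) (p : E × E) : E := (-(1 / 2) : ℝ) • (Γ p).2

/-- The horizontal lift `aⁱ Hᵢ` at `p` of a vector `a`, where `Hᵢ = ∂/∂xⁱ - Γʲᵢ ∂/∂yʲ` and
`Γʲᵢ = ∂Γʲ/∂yⁱ`. -/
def horizontalLift (Γ : E × E → E × E) (p : E × E) (a : E) : E × E :=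
  (a, -(fderiv ℝ (sprayCoeff Γ) p (0, a)))

/-- The four properties, with respect to a spray `Γ`, of a smooth 2-form `Ω` on the slit tangent
bundle over `V`: its characteristic distribution contains `𝒟`; `ℒ_Γ Ω = 0`; `Ω` vanishes on pairs of
vertical vectors; `dΩ(H, V₁, V₂) = 0` for `H` horizontal and `V₁`, `V₂` vertical. -/
structure HasHilbertProperties (V : Set E) (Γ : E × E → E × E)
    (Ω : E × E → (E × E) [⋀^Fin 2]→L[ℝ] ℝ) : Prop where
  smooth : ContDiffOn ℝ ∞ Ω (slit V)
  distribution_le : ∀ p ∈ slit V, sprayDistribution Γ p ≤ characteristicDistribution Ω p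
  lieDeriv_eq_zero : ∀ p ∈ slit V, ∀ u v : E × E, lieDeriv Γ Ω p u v = 0
  vertical : ∀ p ∈ slit V, ∀ a b : E, Ω p ![(0, a), (0, b)] = 0
  extDeriv_eq_zero : ∀ p ∈ slit V, ∀ a b c : E,
    extDeriv Ω p ![horizontalLift Γ p a, (0, b), (0, c)] = 0

end Local

end SprayGeometry

end

/-!
Only the part of the slit tangent bundle over the chart domain matters, an open set `V` of `ℝⁿ`
times `ℝⁿ \ {0}`: a projective class is the projective class of each of its members
(`projectiveClass_eq_of_mem`). Write `θ_F = ∂F/∂yⁱ dxⁱ` for the Hilbert 1-form of `F`. Through every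
point of the slit tangent bundle passes an integral curve of a spray `Γ`, so its geodesics solve the
Euler–Lagrange equations exactly when the equations hold pointwise along `Γ`
(`IsSprayOn.forall_solvesEulerLagrange_iff`); by homogeneity this says that `i_Γ dθ_F = 0`.

For (a), the form is `Ω = dθ_F`. Quasi-regularity says that `Δ` and `Γ` span its kernel, and
`ℒ_Γ Ω = 0` by Cartan's formula (`IsPseudoFinsler.hasHilbertProperties`).

For (b), the four properties force `dΩ = 0`
(`HasHilbertProperties.trilin_extDeriv_eq_zero`): the 3-form `dΩ` is annihilated by `Γ` and closed,
so it is invariant under `Γ`, and bracketing with `Γ` turns vertical vectors into horizontal ones.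
Contracting the base smoothly within itself (`exists_smooth_contraction`) carries the slit tangent
bundle into one fibre, where `Ω` vanishes, so the homotopy operator gives a primitive `K` of `Ω`
(`exists_primitive_of_homotopy`). The restriction of `K` to the fibres is closed; since
`ℝⁿ \ {0}` is simply connected for `n ≥ 3`, it is the differential along the fibres of a function
`f` (`exists_fibre_primitive`), and `θ = K - df` is a horizontal primitive of `Ω`. That `Ω` is
annihilated by `Γ` and `Δ` and by nothing else makes `θ` the Hilbert 1-form of the pseudo-Finsler
function `F = θ(Γ)` (`exists_isPseudoFinsler_of_primitive`).

It remains to see that the geodesic class of `F` is a projective class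
(`IsPseudoFinsler.geodesicClass_eq`). Two sprays in the geodesic class differ by a multiple `λ Δ`,
and solving a linear second-order equation for the parameter turns the geodesics of one into those
of the other; conversely, the Euler–Lagrange equations of a function homogeneous of degree 1 do not
depend on the parametrization.
-/

noncomputable section

set_option maxSynthPendingDepth 3

namespace SprayGeometry

/-! ### Forms of low degree as multilinear maps -/

section Forms

variable {X : Type*} [NormedAddCommGroup X] [NormedSpace ℝ X]

/-- An alternating 2-form as a bilinear form. -/
def bilin : (X [⋀^Fin 2]→L[ℝ] ℝ) →L[ℝ] X →L[ℝ] X →L[ℝ] ℝ :=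
  (ContinuousLinearMap.compL ℝ X (X [⋀^Fin 1]→L[ℝ] ℝ) (X →L[ℝ] ℝ)
    (ContinuousAlternatingMap.ofSubsingletonLIE (𝕜 := ℝ) (E := X) (F := ℝ)
      (0 : Fin 1)).symm.toContinuousLinearEquiv.toContinuousLinearMap).comp
    ContinuousAlternatingMap.curryLeftLI.toContinuousLinearMap

/-- An alternating 3-form as a trilinear form. -/
def trilin : (X [⋀^Fin 3]→L[ℝ] ℝ) →L[ℝ] X →L[ℝ] X →L[ℝ] X →L[ℝ] ℝ :=
  (ContinuousLinearMap.compL ℝ X (X [⋀^Fin 2]→L[ℝ] ℝ) (X →L[ℝ] X →L[ℝ] ℝ) bilin).comp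
    ContinuousAlternatingMap.curryLeftLI.toContinuousLinearMap

theorem bilin_apply (η : X [⋀^Fin 2]→L[ℝ] ℝ) (u v : X) : bilin η u v = η ![u, v] := by
  change η (Matrix.vecCons u fun _ => v) = _
  congr 1
  ext i
  fin_cases i <;> rfl

theorem trilin_apply (η : X [⋀^Fin 3]→L[ℝ] ℝ) (u v w : X) : trilin η u v w = η ![u, v, w] := by
  change bilin (ContinuousAlternatingMap.curryLeft η u) v w = _
  rw [bilin_apply]
  rfl

theorem bilin_swap (η : X [⋀^Fin 2]→L[ℝ] ℝ) (u v : X) : bilin η u v = -bilin η v u := by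
  rw [bilin_apply, bilin_apply]
  have := η.toAlternatingMap.map_swap ![u, v] (i := 0) (j := 1) (by decide)
  have h2 : (![u, v] ∘ Equiv.swap (0 : Fin 2) 1) = ![v, u] := by
    ext i
    fin_cases i <;> rfl
  rw [h2] at this
  change η ![v, u] = -η ![u, v] at this
  linarith

theorem trilin_swap_right (η : X [⋀^Fin 3]→L[ℝ] ℝ) (u v w : X) :
    trilin η u v w = -trilin η u w v :=
  bilin_swap (ContinuousAlternatingMap.curryLeft η u) v w

theorem trilin_swap_left (η : X [⋀^Fin 3]→L[ℝ] ℝ) (u v w : X) :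
    trilin η u v w = -trilin η v u w := by
  rw [trilin_apply, trilin_apply]
  have := η.toAlternatingMap.map_swap ![u, v, w] (i := 0) (j := 1) (by decide)
  have h2 : (![u, v, w] ∘ Equiv.swap (0 : Fin 3) 1) = ![v, u, w] := by
    ext i
    fin_cases i <;> rfl
  rw [h2] at this
  change η ![v, u, w] = -η ![u, v, w] at this
  linarith

theorem contDiffOn_bilin {Ω : X → X [⋀^Fin 2]→L[ℝ] ℝ} {S : Set X} (h : ContDiffOn ℝ ∞ Ω S) :
    ContDiffOn ℝ ∞ (fun p => bilin (Ω p)) S :=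
  (bilin (X := X)).contDiff.comp_contDiffOn h

theorem fderiv_bilin {Ω : X → X [⋀^Fin 2]→L[ℝ] ℝ} {p : X} (h : DifferentiableAt ℝ Ω p)
    (u : X) : fderiv ℝ (fun q => bilin (Ω q)) p u = bilin (fderiv ℝ Ω p u) :=
  DFunLike.congr_fun ((bilin (X := X)).hasFDerivAt.comp p h.hasFDerivAt).fderiv u

theorem extDeriv_one_apply {θ : X → X →L[ℝ] ℝ} {p : X} (h : DifferentiableAt ℝ θ p) (u v : X) :
    extDeriv (fun q => ContinuousAlternatingMap.ofSubsingletonLIE (𝕜 := ℝ) (E := X) (F := ℝ)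
      (0 : Fin 1) (θ q)) p ![u, v] = fderiv ℝ θ p u v - fderiv ℝ θ p v u := by
  have h1 := ((ContinuousAlternatingMap.ofSubsingletonLIE (𝕜 := ℝ) (E := X) (F := ℝ)
    (0 : Fin 1)).toContinuousLinearEquiv.toContinuousLinearMap.hasFDerivAt.comp p
      h.hasFDerivAt).fderiv
  change fderiv ℝ (fun q => ContinuousAlternatingMap.ofSubsingletonLIE (𝕜 := ℝ) (E := X)
    (F := ℝ) (0 : Fin 1) (θ q)) p = _ at h1
  rw [extDeriv, h1, ContinuousAlternatingMap.alternatizeUncurryFin_apply, Fin.sum_univ_two]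
  simp [Fin.removeNth, sub_eq_add_neg]

theorem trilin_extDeriv (Ω : X → X [⋀^Fin 2]→L[ℝ] ℝ) (p u v w : X) :
    trilin (extDeriv Ω p) u v w = bilin (fderiv ℝ Ω p u) v w - bilin (fderiv ℝ Ω p v) u w
      + bilin (fderiv ℝ Ω p w) u v := by
  have h0 : Fin.removeNth (0 : Fin 3) ![u, v, w] = ![v, w] := by
    ext i; fin_cases i <;> rfl
  have h1 : Fin.removeNth (1 : Fin 3) ![u, v, w] = ![u, w] := by
    ext i; fin_cases i <;> rfl
  have h2 : Fin.removeNth (2 : Fin 3) ![u, v, w] = ![u, v] := by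
    ext i; fin_cases i <;> rfl
  rw [trilin_apply, extDeriv, ContinuousAlternatingMap.alternatizeUncurryFin_apply,
    Fin.sum_univ_three, h0, h1, h2]
  simp [bilin_apply]
  ring

theorem extDeriv_three_apply (Ω : X → X [⋀^Fin 3]→L[ℝ] ℝ) (p z u v w : X) :
    extDeriv Ω p ![z, u, v, w] = trilin (fderiv ℝ Ω p z) u v w - trilin (fderiv ℝ Ω p u) z v w
      + trilin (fderiv ℝ Ω p v) z u w - trilin (fderiv ℝ Ω p w) z u v := by
  have h0 : Fin.removeNth (0 : Fin 4) ![z, u, v, w] = ![u, v, w] := by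
    ext i; fin_cases i <;> rfl
  have h1 : Fin.removeNth (1 : Fin 4) ![z, u, v, w] = ![z, v, w] := by
    ext i; fin_cases i <;> rfl
  have h2 : Fin.removeNth (2 : Fin 4) ![z, u, v, w] = ![z, u, w] := by
    ext i; fin_cases i <;> rfl
  have h3 : Fin.removeNth (3 : Fin 4) ![z, u, v, w] = ![z, u, v] := by
    ext i; fin_cases i <;> rfl
  rw [extDeriv, ContinuousAlternatingMap.alternatizeUncurryFin_apply,
    Fin.sum_univ_four, h0, h1, h2, h3]
  simp [trilin_apply]
  ring

/-- Cartan's formula for a 2-form annihilated by `Y`: differentiating `i_Y Ω = 0` turns `i_Y dΩ`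
into the Lie derivative. -/
theorem cartan_two {Ω : X → X [⋀^Fin 2]→L[ℝ] ℝ} {Y : X → X} {p : X}
    (hΩ : DifferentiableAt ℝ Ω p) (hY : DifferentiableAt ℝ Y p)
    (hi : ∀ᶠ q in 𝓝 p, ∀ v, bilin (Ω q) (Y q) v = 0) (u v : X) :
    trilin (extDeriv Ω p) (Y p) u v = bilin (fderiv ℝ Ω p (Y p)) u v
      + bilin (Ω p) (fderiv ℝ Y p u) v + bilin (Ω p) u (fderiv ℝ Y p v) := by
  have key : ∀ a b, bilin (fderiv ℝ Ω p a) (Y p) b + bilin (Ω p) (fderiv ℝ Y p a) b = 0 := by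
    intro a b
    have h1 := ((bilin.hasFDerivAt.comp p hΩ.hasFDerivAt).clm_apply hY.hasFDerivAt).clm_apply
      (hasFDerivAt_const b p)
    have h2 : (fun q => bilin (Ω q) (Y q) b) =ᶠ[𝓝 p] fun _ => 0 := hi.mono fun q hq => hq b
    have h3 := h1.unique ((hasFDerivAt_const (0 : ℝ) p).congr_of_eventuallyEq h2)
    have h4 := DFunLike.congr_fun h3 a
    simp at h4
    linarith
  rw [trilin_extDeriv, bilin_swap (Ω p) u]
  linarith [key u v, key v u]

/-- Cartan's formula for a closed 3-form annihilated by `Y`: its Lie derivative along `Y` is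
zero. -/
theorem cartan_three {Φ : X → X [⋀^Fin 3]→L[ℝ] ℝ} {Y : X → X} {p : X}
    (hΦ : DifferentiableAt ℝ Φ p) (hY : DifferentiableAt ℝ Y p)
    (hi : ∀ᶠ q in 𝓝 p, ∀ v w, trilin (Φ q) (Y q) v w = 0) (hd : extDeriv Φ p = 0) (u v w : X) :
    trilin (fderiv ℝ Φ p (Y p)) u v w + trilin (Φ p) (fderiv ℝ Y p u) v w
      + trilin (Φ p) u (fderiv ℝ Y p v) w + trilin (Φ p) u v (fderiv ℝ Y p w) = 0 := by
  have key : ∀ a b c,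
      trilin (fderiv ℝ Φ p a) (Y p) b c + trilin (Φ p) (fderiv ℝ Y p a) b c = 0 := by
    intro a b c
    have h1 := (((trilin.hasFDerivAt.comp p hΦ.hasFDerivAt).clm_apply hY.hasFDerivAt).clm_apply
      (hasFDerivAt_const b p)).clm_apply (hasFDerivAt_const c p)
    have h2 : (fun q => trilin (Φ q) (Y q) b c) =ᶠ[𝓝 p] fun _ => 0 := hi.mono fun q hq => hq b c
    have h3 := h1.unique ((hasFDerivAt_const (0 : ℝ) p).congr_of_eventuallyEq h2)
    have h4 := DFunLike.congr_fun h3 a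
    simp at h4
    linarith
  have h5 := extDeriv_three_apply Φ p (Y p) u v w
  rw [hd] at h5
  change (0 : ℝ) = _ at h5
  rw [trilin_swap_left (Φ p) u, trilin_swap_right (Φ p) u v, trilin_swap_left (Φ p) u]
  linarith [key u v w, key v u w, key w u v]

end Forms

/-! ### Homogeneity -/

section Homogeneity

variable {E : Type*} [NormedAddCommGroup E] [NormedSpace ℝ E]
  {F : Type*} [NormedAddCommGroup F] [NormedSpace ℝ F]

theorem isOpen_slit {E : Type*} [NormedAddCommGroup E] {V : Set E} (hV : IsOpen V) :
    IsOpen (slit V) :=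
  (hV.preimage continuous_fst).inter (isOpen_compl_singleton.preimage continuous_snd)

theorem slit_smul {V : Set E} {p : E × E} (hp : p ∈ slit V) {r : ℝ} (hr : 0 < r) :
    ((p.1, r • p.2) : E × E) ∈ slit V :=
  ⟨hp.1, smul_ne_zero hr.ne' hp.2⟩

/-- Euler's theorem: `y ∂G/∂y = k G` makes `G` positively homogeneous of degree `k` along the
fibres. -/
theorem homogeneous_of_euler {V : Set E} {G : E × E → F} (k : ℕ)
    (hG : ∀ p ∈ slit V, DifferentiableAt ℝ G p)
    (he : ∀ p ∈ slit V, fderiv ℝ G p (0, p.2) = (k : ℝ) • G p)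
    {p : E × E} (hp : p ∈ slit V) {r : ℝ} (hr : 0 < r) :
    G (p.1, r • p.2) = r ^ k • G p := by
  have hd : ∀ s ∈ Ioi (0 : ℝ), HasDerivAt (fun s : ℝ => (s ^ k)⁻¹ • G (p.1, s • p.2)) 0 s := by
    intro s hs
    have hs' : (0 : ℝ) < s := hs
    have h1 : HasDerivAt (fun s : ℝ => ((p.1, s • p.2) : E × E)) (0, p.2) s := by
      simpa using! (hasDerivAt_const s p.1).prodMk ((hasDerivAt_id s).smul_const p.2)
    have h2 := (hG _ (slit_smul hp hs')).hasFDerivAt.comp_hasDerivAt s h1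
    have h3 : fderiv ℝ G (p.1, s • p.2) (0, p.2) = s⁻¹ • (k : ℝ) • G (p.1, s • p.2) := by
      rw [← he _ (slit_smul hp hs'), ← map_smul]
      simp [smul_smul, hs'.ne']
    rw [h3] at h2
    have h4 := ((hasDerivAt_pow k s).inv (pow_ne_zero k hs'.ne')).smul h2
    refine h4.congr_deriv ?_
    simp only [Pi.inv_apply, Function.comp_apply]
    rw [smul_smul, smul_smul, ← add_smul]
    convert! zero_smul ℝ _ using 2
    -- The exponent `k - 1` of the derivative is truncated at `k = 0`.
    rcases k with _ | k
    · simp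
    · simp only [Nat.add_sub_cancel, pow_succ]
      field_simp
      simp
  have h5 := (convex_Ioi (0 : ℝ)).is_const_of_fderivWithin_eq_zero (𝕜 := ℝ)
    (f := fun s : ℝ => (s ^ k)⁻¹ • G (p.1, s • p.2))
    (fun s hs => (hd s hs).differentiableAt.differentiableWithinAt)
    (fun s hs => by
      rw [fderivWithin_of_isOpen isOpen_Ioi hs]
      ext
      simpa using (hd s hs).deriv) (x := r) (y := 1) hr (mem_Ioi.2 one_pos)
  simp at h5
  rw [← h5, smul_smul, mul_inv_cancel₀ (pow_ne_zero k hr.ne'), one_smul]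

end Homogeneity

theorem minSmoothness_two_le_infty : minSmoothness ℝ 2 ≤ ∞ := by
  rw [minSmoothness_of_isRCLikeNormedField]
  exact WithTop.coe_le_coe.2 le_top

/-! ### Sprays, integral curves and the Euler–Lagrange equations -/

section EulerLagrange

variable {E : Type*} [NormedAddCommGroup E] [NormedSpace ℝ E] {V : Set E}
  {Γ Γ' : E × E → E × E} {F : E × E → ℝ}

theorem IsSprayOn.differentiableAt (hΓ : IsSprayOn V Γ) (hV : IsOpen V) {p : E × E}
    (hp : p ∈ slit V) : DifferentiableAt ℝ Γ p :=
  (hΓ.smooth.contDiffAt ((isOpen_slit hV).mem_nhds hp)).differentiableAt (by simp)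

theorem IsSprayOn.eq_mk (hΓ : IsSprayOn V Γ) {p : E × E} (hp : p ∈ slit V) :
    Γ p = (p.2, (Γ p).2) :=
  Prod.ext (hΓ.second_order p hp) rfl

/-- The vertical component of a spray is positively homogeneous of degree 2. -/
theorem IsSprayOn.snd_smul (hΓ : IsSprayOn V Γ) (hV : IsOpen V) {p : E × E} (hp : p ∈ slit V)
    {r : ℝ} (hr : 0 < r) : (Γ (p.1, r • p.2)).2 = r ^ 2 • (Γ p).2 := by
  refine homogeneous_of_euler (G := fun q => (Γ q).2) 2
    (fun q hq => (hΓ.differentiableAt hV hq).snd) (fun q hq => ?_) hp hr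
  have h1 := hΓ.homogeneous q hq
  have hΔ : fderiv ℝ (Δ : E × E → E × E) q = (0 : E × E →L[ℝ] E).prod (.snd ℝ E E) :=
    ((hasFDerivAt_const (0 : E) q).prodMk hasFDerivAt_snd).fderiv
  rw [VectorField.lieBracket, hΔ] at h1
  have h2 := congrArg Prod.snd h1
  have h3 : fderiv ℝ (fun q => (Γ q).2) q (0, q.2) = (fderiv ℝ Γ q (0, q.2)).2 :=
    DFunLike.congr_fun (hΓ.differentiableAt hV hq).hasFDerivAt.snd.fderiv _
  simp only [Δ, Prod.snd_sub, ContinuousLinearMap.prod_apply, ContinuousLinearMap.coe_snd'] at h2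
  rw [h3, eq_add_of_sub_eq h2]
  push_cast
  rw [two_smul]

theorem IsSprayOn.exists_integralCurve [CompleteSpace E] (hΓ : IsSprayOn V Γ) (hV : IsOpen V)
    {p : E × E} (hp : p ∈ slit V) : ∃ (γ : ℝ → E × E) (ε : ℝ), 0 < ε ∧ γ 0 = p ∧
      ∀ t ∈ Ioo (-ε) ε, γ t ∈ slit V ∧ HasDerivAt γ (Γ (γ t)) t := by
  have h1 : ContDiffAt ℝ 1 Γ p :=
    (hΓ.smooth.contDiffAt ((isOpen_slit hV).mem_nhds hp)).of_le (by exact_mod_cast le_top)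
  obtain ⟨r, hr, ε, hε, h⟩ :=
    h1.exists_forall_mem_closedBall_exists_eq_forall_mem_Ioo_hasDerivAt 0
  obtain ⟨γ, hγ0, hγ⟩ := h p (Metric.mem_closedBall_self hr.le)
  simp only [zero_sub, zero_add] at hγ
  have hc : ContinuousAt γ 0 := (hγ 0 ⟨by linarith, hε⟩).continuousAt
  have h2 : ∀ᶠ t in 𝓝 (0 : ℝ), γ t ∈ slit V :=
    hc.eventually (by rw [hγ0]; exact (isOpen_slit hV).mem_nhds hp)
  obtain ⟨δ, hδ, h3⟩ := Metric.eventually_nhds_iff.1 h2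
  refine ⟨γ, min δ ε, lt_min hδ hε, hγ0, fun t ht => ⟨h3 ?_, hγ t ⟨?_, ?_⟩⟩⟩
  · rw [Real.dist_eq, sub_zero, abs_lt]
    exact ⟨by linarith [ht.1, min_le_left δ ε], by linarith [ht.2, min_le_left δ ε]⟩
  · linarith [ht.1, min_le_right δ ε]
  · linarith [ht.2, min_le_right δ ε]

/-- The tangent lift of a geodesic is an integral curve of the spray. -/
theorem IsSprayOn.hasDerivAt_geodesic (hΓ : IsSprayOn V Γ) {c : ℝ → E} {γ : ℝ → E × E} {J : Set ℝ}
    (hJ : IsOpen J)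
    (hγ : ∀ t ∈ J, γ t ∈ slit V ∧ HasDerivAt γ (Γ (γ t)) t ∧ (γ t).1 = c t) {t : ℝ} (ht : t ∈ J) :
    HasDerivAt c (γ t).2 t := by
  have h1 := (hγ t ht).2.1.hasFDerivAt.fst.hasDerivAt
  have h2 : HasDerivAt (fun s => (γ s).1) (γ t).2 t := by
    refine h1.congr_deriv ?_
    simp [hΓ.second_order _ (hγ t ht).1]
  exact h2.congr_of_eventuallyEq
    (Filter.mem_of_superset (hJ.mem_nhds ht) fun s hs => (hγ s hs).2.2.symm)

theorem hasDerivAt_fderiv_comp (hV : IsOpen V) (hF : ContDiffOn ℝ ∞ F (slit V)) {γ : ℝ → E × E}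
    {t : ℝ} {γ' : E × E} (ht : γ t ∈ slit V) (hγ : HasDerivAt γ γ' t) (v : E × E) :
    HasDerivAt (fun s => fderiv ℝ F (γ s) v) (fderiv ℝ (fderiv ℝ F) (γ t) γ' v) t := by
  have h1 := hF.fderiv_of_isOpen (m := ∞) (isOpen_slit hV) (by simp)
  have h2 := (h1.contDiffAt ((isOpen_slit hV).mem_nhds ht)).differentiableAt (by simp)
  exact ((h2.hasFDerivAt.comp_hasDerivAt t hγ).clm_apply (hasDerivAt_const t v)).congr_deriv
    (by simp)

/-- The geodesics of a spray solve the Euler–Lagrange equations of `F` exactly when the equations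
hold pointwise, with the derivative along the curve replaced by that along the spray. -/
theorem IsSprayOn.forall_solvesEulerLagrange_iff [CompleteSpace E] (hΓ : IsSprayOn V Γ)
    (hV : IsOpen V) (hF : ContDiffOn ℝ ∞ F (slit V)) :
    (∀ (c : ℝ → E) (J : Set ℝ), IsGeodesicOn V Γ c J → SolvesEulerLagrange F c J) ↔
      ∀ p ∈ slit V, ∀ a : E, fderiv ℝ (fderiv ℝ F) p (Γ p) (0, a) = fderiv ℝ F p (a, 0) := by
  have key : ∀ (c : ℝ → E) (J : Set ℝ) (γ : ℝ → E × E), IsOpen J →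
      (∀ t ∈ J, γ t ∈ slit V ∧ HasDerivAt γ (Γ (γ t)) t ∧ (γ t).1 = c t) → ∀ t ∈ J, ∀ a,
      (c t, deriv c t) = γ t ∧ HasDerivAt (fun s => fderiv ℝ F (c s, deriv c s) (0, a))
        (fderiv ℝ (fderiv ℝ F) (γ t) (Γ (γ t)) (0, a)) t := by
    intro c J γ hJ hγ t ht a
    have h1 : ∀ s ∈ J, (c s, deriv c s) = γ s := fun s hs =>
      Prod.ext (hγ s hs).2.2.symm (hΓ.hasDerivAt_geodesic hJ hγ hs).deriv
    refine ⟨h1 t ht, ?_⟩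
    refine (hasDerivAt_fderiv_comp hV hF (hγ t ht).1 (hγ t ht).2.1 (0, a)).congr_of_eventuallyEq ?_
    filter_upwards [hJ.mem_nhds ht] with s hs
    rw [h1 s hs]
  constructor
  · intro h p hp a
    obtain ⟨γ, ε, hε, h0, hγ⟩ := hΓ.exists_integralCurve hV hp
    have hγ' : ∀ t ∈ Ioo (-ε) ε,
        γ t ∈ slit V ∧ HasDerivAt γ (Γ (γ t)) t ∧ (γ t).1 = (fun s => (γ s).1) t :=
      fun t ht => ⟨(hγ t ht).1, (hγ t ht).2, rfl⟩
    have h1 : (0 : ℝ) ∈ Ioo (-ε) ε := ⟨by linarith, hε⟩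
    obtain ⟨h2, h3⟩ := key _ _ γ isOpen_Ioo hγ' 0 h1 a
    have h4 := (h _ _ ⟨isOpen_Ioo, ordConnected_Ioo, γ, hγ'⟩ 0 h1 a).unique h3
    rw [h2, h0] at h4
    exact h4.symm
  · rintro h c J ⟨hJ, -, γ, hγ⟩ t ht a
    obtain ⟨h2, h3⟩ := key c J γ hJ hγ t ht a
    rw [h2, ← h _ (hγ t ht).1]
    exact h3

theorem isSymmSndFDerivAt_of_contDiffOn_slit (hV : IsOpen V) (hF : ContDiffOn ℝ ∞ F (slit V))
    {p : E × E} (hp : p ∈ slit V) : IsSymmSndFDerivAt ℝ F p :=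
  (hF.contDiffAt ((isOpen_slit hV).mem_nhds hp)).isSymmSndFDerivAt
    minSmoothness_two_le_infty

theorem differentiableAt_fderiv_slit (hV : IsOpen V) (hF : ContDiffOn ℝ ∞ F (slit V))
    {p : E × E} (hp : p ∈ slit V) : DifferentiableAt ℝ (fderiv ℝ F) p :=
  ((hF.fderiv_of_isOpen (m := ∞) (isOpen_slit hV) (by simp)).contDiffAt
    ((isOpen_slit hV).mem_nhds hp)).differentiableAt (by simp)

theorem fibreHessian_eq (hV : IsOpen V) (hF : ContDiffOn ℝ ∞ F (slit V)) {p : E × E}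
    (hp : p ∈ slit V) (u v : E) :
    fibreHessian F p u v = fderiv ℝ (fderiv ℝ F) p (0, u) (0, v) := by
  have h := ((differentiableAt_fderiv_slit hV hF hp).hasFDerivAt.clm_apply
    (hasFDerivAt_const ((0, v) : E × E) p)).fderiv
  rw [fibreHessian, h]
  simp

/-- The Euler relation of a function that is positively homogeneous of degree 1. -/
theorem IsPseudoFinsler.euler (hF : IsPseudoFinsler V F) (hV : IsOpen V) {p : E × E}
    (hp : p ∈ slit V) : fderiv ℝ F p (0, p.2) = F p := by
  have h1 : HasDerivAt (fun s : ℝ => ((p.1, s • p.2) : E × E)) (0, p.2) 1 := by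
    simpa using! (hasDerivAt_const (1 : ℝ) p.1).prodMk ((hasDerivAt_id (1 : ℝ)).smul_const p.2)
  have h0 : DifferentiableAt ℝ F p :=
    (hF.smooth.contDiffAt ((isOpen_slit hV).mem_nhds hp)).differentiableAt (by simp)
  have h2 := h0.hasFDerivAt.comp_hasDerivAt_of_eq 1 h1 (by simp)
  have h3 : HasDerivAt (fun s : ℝ => s * F p) (F p) 1 := by
    simpa using (hasDerivAt_id (1 : ℝ)).mul_const (F p)
  refine h2.unique (h3.congr_of_eventuallyEq ?_)
  filter_upwards [Ioi_mem_nhds (zero_lt_one' ℝ)] with s hs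
  exact hF.homogeneous p hp s hs

/-- The differentiated Euler relation. -/
theorem IsPseudoFinsler.euler_fderiv (hF : IsPseudoFinsler V F) (hV : IsOpen V) {p : E × E}
    (hp : p ∈ slit V) (u w : E) :
    fderiv ℝ (fderiv ℝ F) p (u, w) (0, p.2) = fderiv ℝ F p (u, 0) := by
  have h0 : DifferentiableAt ℝ F p :=
    (hF.smooth.contDiffAt ((isOpen_slit hV).mem_nhds hp)).differentiableAt (by simp)
  have h1 : HasFDerivAt (fun q : E × E => ((0, q.2) : E × E))
      ((0 : E × E →L[ℝ] E).prod (.snd ℝ E E)) p :=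
    (hasFDerivAt_const (0 : E) p).prodMk hasFDerivAt_snd
  have h2 := (differentiableAt_fderiv_slit hV hF.smooth hp).hasFDerivAt.clm_apply h1
  have h3 := h2.unique (h0.hasFDerivAt.congr_of_eventuallyEq
    (Filter.mem_of_superset ((isOpen_slit hV).mem_nhds hp) fun q hq => hF.euler hV hq))
  have h4 := DFunLike.congr_fun h3 (u, w)
  have h5 : fderiv ℝ F p (u, w) = fderiv ℝ F p (u, 0) + fderiv ℝ F p (0, w) := by
    rw [← map_add]
    simp
  simp at h4
  linarith

/-- Two sprays whose geodesics solve the Euler–Lagrange equations of `F` differ by a multiple of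
the Liouville field. -/
theorem IsPseudoFinsler.exists_smul_of_eulerLagrange (hF : IsPseudoFinsler V F) (hV : IsOpen V)
    (hΓ : IsSprayOn V Γ) (hΓ' : IsSprayOn V Γ') {p : E × E} (hp : p ∈ slit V)
    (h : ∀ a : E, fderiv ℝ (fderiv ℝ F) p (Γ p) (0, a) = fderiv ℝ F p (a, 0))
    (h' : ∀ a : E, fderiv ℝ (fderiv ℝ F) p (Γ' p) (0, a) = fderiv ℝ F p (a, 0)) :
    ∃ k : ℝ, (Γ' p).2 - (Γ p).2 = k • p.2 := by
  refine (hF.quasiRegular p hp _).1 fun u => ?_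
  rw [fibreHessian_eq hV hF.smooth hp,
    isSymmSndFDerivAt_of_contDiffOn_slit hV hF.smooth hp (0, u)]
  have h1 : ((0, (Γ' p).2 - (Γ p).2) : E × E) = Γ' p - Γ p := by
    rw [hΓ.eq_mk hp, hΓ'.eq_mk hp]
    simp
  rw [h1, map_sub, sub_apply, h, h', sub_self]

end EulerLagrange

/-! ### The Hilbert 2-form of a pseudo-Finsler function -/

section HilbertForm

variable {E : Type*} [NormedAddCommGroup E] [NormedSpace ℝ E] {V : Set E}
  {Γ : E × E → E × E} {F : E × E → ℝ}

theorem mem_characteristicDistribution {Ω : E × E → (E × E) [⋀^Fin 2]→L[ℝ] ℝ} {p v : E × E} :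
    v ∈ characteristicDistribution Ω p ↔ ∀ w, bilin (Ω p) v w = 0 := by
  rw [characteristicDistribution, LinearMap.mem_ker]
  constructor
  · intro h w
    rw [bilin_apply]
    exact DFunLike.congr_fun h ![w]
  · intro h
    ext w
    have h1 := h (w 0)
    rw [bilin_apply] at h1
    have h2 : w = ![w 0] := funext fun i => by
      fin_cases i
      rfl
    change Ω p (Matrix.vecCons v w) = 0
    rw [h2]
    exact h1

theorem mem_sprayDistribution {p v : E × E} :
    v ∈ sprayDistribution Γ p ↔ ∃ a b : ℝ, a • Δ p + b • Γ p = v := by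
  rw [sprayDistribution, Submodule.mem_span_pair]

theorem lieDeriv_eq (X : E × E → E × E) (Ω : E × E → (E × E) [⋀^Fin 2]→L[ℝ] ℝ) (p u v : E × E) :
    lieDeriv X Ω p u v = bilin (fderiv ℝ Ω p (X p)) u v + bilin (Ω p) (fderiv ℝ X p u) v
      + bilin (Ω p) u (fderiv ℝ X p v) := by
  simp only [lieDeriv, bilin_apply]

/-- The Hilbert 1-form `∂F/∂yⁱ dxⁱ` of a function `F`. -/
def hilbertOneForm (F : E × E → ℝ) (p : E × E) : E × E →L[ℝ] ℝ :=
  (fderiv ℝ F p).comp ((ContinuousLinearMap.inr ℝ E E).comp (ContinuousLinearMap.fst ℝ E E))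

/-- The Hilbert 2-form of `F`, the exterior derivative of its Hilbert 1-form. -/
def hilbertTwoForm (F : E × E → ℝ) : E × E → (E × E) [⋀^Fin 2]→L[ℝ] ℝ :=
  extDeriv fun q => ContinuousAlternatingMap.ofSubsingletonLIE (𝕜 := ℝ) (E := E × E) (F := ℝ)
    (0 : Fin 1) (hilbertOneForm F q)

theorem contDiffOn_hilbertOneForm (hV : IsOpen V) (hF : ContDiffOn ℝ ∞ F (slit V)) :
    ContDiffOn ℝ ∞ (hilbertOneForm F) (slit V) :=
  (hF.fderiv_of_isOpen (m := ∞) (isOpen_slit hV) (by simp)).clm_comp contDiffOn_const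

theorem contDiffOn_ofSubsingletonLIE {X : Type*} [NormedAddCommGroup X] [NormedSpace ℝ X]
    {θ : X → X →L[ℝ] ℝ} {S : Set X} (h : ContDiffOn ℝ ∞ θ S) :
    ContDiffOn ℝ ∞ (fun q => ContinuousAlternatingMap.ofSubsingletonLIE (𝕜 := ℝ) (E := X)
      (F := ℝ) (0 : Fin 1) (θ q)) S :=
  (ContinuousAlternatingMap.ofSubsingletonLIE (𝕜 := ℝ) (E := X)
      (F := ℝ) (0 : Fin 1)).contDiff.comp_contDiffOn h

theorem contDiffOn_extDeriv {X : Type*} [NormedAddCommGroup X] [NormedSpace ℝ X] {k : ℕ}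
    {Ω : X → X [⋀^Fin k]→L[ℝ] ℝ} {S : Set X} (hS : IsOpen S) (h : ContDiffOn ℝ ∞ Ω S) :
    ContDiffOn ℝ ∞ (extDeriv Ω) S :=
  (ContinuousAlternatingMap.alternatizeUncurryFinCLM ℝ X ℝ).contDiff.comp_contDiffOn
    (h.fderiv_of_isOpen (m := ∞) hS (by simp))

theorem bilin_hilbertTwoForm (hV : IsOpen V) (hF : ContDiffOn ℝ ∞ F (slit V)) {p : E × E}
    (hp : p ∈ slit V) (u v : E × E) :
    bilin (hilbertTwoForm F p) u v
      = fderiv ℝ (fderiv ℝ F) p u (0, v.1) - fderiv ℝ (fderiv ℝ F) p v (0, u.1) := by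
  have h0 : HasFDerivAt (hilbertOneForm F) _ p :=
    (differentiableAt_fderiv_slit hV hF hp).hasFDerivAt.clm_comp
      (hasFDerivAt_const ((ContinuousLinearMap.inr ℝ E E).comp (ContinuousLinearMap.fst ℝ E E)) p)
  rw [bilin_apply, hilbertTwoForm, extDeriv_one_apply h0.differentiableAt, h0.fderiv]
  simp

/-- The Hilbert 2-form of a pseudo-Finsler function has the four properties with respect to every
spray whose geodesics solve the Euler–Lagrange equations, and is annihilated by `𝒟` only. -/
theorem IsPseudoFinsler.hasHilbertProperties (hF : IsPseudoFinsler V F) (hV : IsOpen V)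
    (hΓ : IsSprayOn V Γ)
    (hEL : ∀ p ∈ slit V, ∀ a : E, fderiv ℝ (fderiv ℝ F) p (Γ p) (0, a) = fderiv ℝ F p (a, 0)) :
    HasHilbertProperties V Γ (hilbertTwoForm F) ∧ ∀ p ∈ slit V,
      characteristicDistribution (hilbertTwoForm F) p = sprayDistribution Γ p := by
  have hS := isOpen_slit hV
  have hsm : ContDiffOn ℝ ∞ (hilbertTwoForm F) (slit V) :=
    contDiffOn_extDeriv hS (contDiffOn_ofSubsingletonLIE (contDiffOn_hilbertOneForm hV hF.smooth))
  have hclosed : ∀ p ∈ slit V, extDeriv (hilbertTwoForm F) p = 0 := fun p hp =>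
    extDeriv_extDeriv_apply ((contDiffOn_ofSubsingletonLIE
      (contDiffOn_hilbertOneForm hV hF.smooth)).contDiffAt (hS.mem_nhds hp))
      minSmoothness_two_le_infty
  have hiΓ : ∀ p ∈ slit V, ∀ v, bilin (hilbertTwoForm F p) (Γ p) v = 0 := by
    rintro p hp ⟨u, w⟩
    rw [bilin_hilbertTwoForm hV hF.smooth hp, hEL p hp, hΓ.second_order p hp,
      hF.euler_fderiv hV hp, sub_self]
  have hiΔ : ∀ p ∈ slit V, ∀ v, bilin (hilbertTwoForm F p) (Δ p) v = 0 := by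
    rintro p hp v
    have h1 := (hF.quasiRegular p hp p.2).2 ⟨1, (one_smul ℝ p.2).symm⟩ v.1
    rw [fibreHessian_eq hV hF.smooth hp] at h1
    rw [bilin_hilbertTwoForm hV hF.smooth hp, Δ,
      isSymmSndFDerivAt_of_contDiffOn_slit hV hF.smooth hp, h1]
    change 0 - fderiv ℝ (fderiv ℝ F) p v 0 = 0
    simp
  have hker : ∀ p ∈ slit V,
      characteristicDistribution (hilbertTwoForm F) p = sprayDistribution Γ p := by
    intro p hp
    apply le_antisymm
    · rintro ⟨u, w⟩ hv
      rw [mem_characteristicDistribution] at hv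
      obtain ⟨k, hk⟩ := (hF.quasiRegular p hp u).1 fun a => by
        have h1 := hv (0, a)
        rw [bilin_hilbertTwoForm hV hF.smooth hp] at h1
        rw [fibreHessian_eq hV hF.smooth hp]
        simp only [Prod.mk_zero_zero, map_zero, zero_sub, neg_eq_zero] at h1
        exact h1
      obtain ⟨l, hl⟩ := (hF.quasiRegular p hp (w - k • (Γ p).2)).1 fun a => by
        have h1 : bilin (hilbertTwoForm F p) ((u, w) - k • Γ p) (a, 0) = 0 := by
          rw [map_sub, map_smul, sub_apply, smul_apply,
            hv, hiΓ p hp]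
          simp
        have h2 : ((u, w) - k • Γ p : E × E) = (0, w - k • (Γ p).2) := by
          rw [hΓ.eq_mk hp, hk]
          simp
        rw [h2, bilin_hilbertTwoForm hV hF.smooth hp] at h1
        rw [fibreHessian_eq hV hF.smooth hp,
          isSymmSndFDerivAt_of_contDiffOn_slit hV hF.smooth hp]
        simp only [Prod.mk_zero_zero, map_zero, sub_zero] at h1
        exact h1
      refine mem_sprayDistribution.2 ⟨l, k, ?_⟩
      rw [hΓ.eq_mk hp, hk, Δ]
      ext1
      · simp
      · simp [← hl]
    · refine Submodule.span_le.2 ?_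
      rintro v (rfl | rfl)
      · exact mem_characteristicDistribution.2 (hiΔ p hp)
      · exact mem_characteristicDistribution.2 (hiΓ p hp)
  refine ⟨⟨hsm, fun p hp => (hker p hp).ge, fun p hp u v => ?_, fun p hp a b => ?_,
    fun p hp a b c => ?_⟩, hker⟩
  · rw [lieDeriv_eq, ← cartan_two ((hsm.contDiffAt (hS.mem_nhds hp)).differentiableAt (by simp))
      (hΓ.differentiableAt hV hp) (Filter.mem_of_superset (hS.mem_nhds hp) hiΓ), hclosed p hp]
    simp
  · rw [← bilin_apply, bilin_hilbertTwoForm hV hF.smooth hp]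
    simp only [Prod.mk_zero_zero, map_zero, sub_zero]
  · rw [hclosed p hp]
    rfl

end HilbertForm

/-! ### Smooth dependence of integrals on parameters -/

section ParametricIntegral

open MeasureTheory

universe u

theorem hasFDerivAt_parametric_integral {X F : Type*} [NormedAddCommGroup X] [NormedSpace ℝ X]
    [FiniteDimensional ℝ X] [NormedAddCommGroup F] [NormedSpace ℝ F]
    {S : Set X} {N : Set (ℝ × X)} (hS : IsOpen S) (hN : IsOpen N) (hSN : Icc 0 1 ×ˢ S ⊆ N)
    {g : ℝ × X → F} (hg : ContDiffOn ℝ ∞ g N) {p : X} (hp : p ∈ S) :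
    HasFDerivAt (fun p => ∫ s in (0 : ℝ)..1, g (s, p))
      (∫ s in (0 : ℝ)..1, (fderiv ℝ g (s, p)).comp (.inr ℝ ℝ X)) p := by
  have hIoc : uIoc (0 : ℝ) 1 ⊆ Icc 0 1 := by
    rw [uIoc_of_le zero_le_one]
    exact Ioc_subset_Icc_self
  have hg' : ContDiffOn ℝ ∞ (fun q => (fderiv ℝ g q).comp (.inr ℝ ℝ X)) N :=
    (hg.fderiv_of_isOpen (m := ∞) hN (by simp)).clm_comp contDiffOn_const
  obtain ⟨ε, hε, hball⟩ := Metric.nhds_basis_closedBall.mem_iff.1 (hS.mem_nhds hp)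
  have : ProperSpace X := FiniteDimensional.proper ℝ X
  have hK : IsCompact (Icc (0 : ℝ) 1 ×ˢ Metric.closedBall p ε) :=
    isCompact_Icc.prod (isCompact_closedBall p ε)
  have hKN : Icc (0 : ℝ) 1 ×ˢ Metric.closedBall p ε ⊆ N :=
    (prod_mono subset_rfl hball).trans hSN
  obtain ⟨C, hC⟩ := hK.exists_bound_of_continuousOn (hg'.continuousOn.mono hKN)
  have hline : ∀ x : X, ContinuousOn (fun s : ℝ => (s, x)) (Icc 0 1) := fun x => by fun_prop
  have hmaps : ∀ x ∈ S, MapsTo (fun s : ℝ => (s, x)) (Icc 0 1) N := fun x hx s hs =>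
    hSN ⟨hs, hx⟩
  have hcont : ∀ x ∈ S, ContinuousOn (fun s => g (s, x)) (Icc 0 1) := fun x hx =>
    hg.continuousOn.comp (hline x) (hmaps x hx)
  refine intervalIntegral.hasFDerivAt_integral_of_dominated_of_fderiv_le
    (bound := fun _ => C) (F' := fun x s => (fderiv ℝ g (s, x)).comp (.inr ℝ ℝ X))
    (Metric.closedBall_mem_nhds p hε) ?_ ?_ ?_ ?_ ?_ ?_
  · filter_upwards [hS.mem_nhds hp] with x hx
    exact ((hcont x hx).mono hIoc).aestronglyMeasurable measurableSet_uIoc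
  · refine ContinuousOn.intervalIntegrable ?_
    rw [uIcc_of_le zero_le_one]
    exact hcont p hp
  · exact ((hg'.continuousOn.comp (hline p) (hmaps p hp)).mono
      hIoc).aestronglyMeasurable measurableSet_uIoc
  · exact Filter.Eventually.of_forall fun s hs x hx => hC (s, x) ⟨hIoc hs, hx⟩
  · exact intervalIntegrable_const
  · refine Filter.Eventually.of_forall fun s hs x hx => ?_
    have h1 : DifferentiableAt ℝ g (s, x) :=
      (hg.contDiffAt (hN.mem_nhds (hKN ⟨hIoc hs, hx⟩))).differentiableAt (by simp)
    exact h1.hasFDerivAt.comp x (hasFDerivAt_prodMk_right s x)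

/-- The derivative is again a parametric integral, with values in `X →L[ℝ] F`; the common universe
of `X` and `F` allows the induction on the order of differentiability to replace `F` by it. -/
theorem contDiffOn_parametric_integral {X F : Type u} [NormedAddCommGroup X] [NormedSpace ℝ X]
    [FiniteDimensional ℝ X] [NormedAddCommGroup F] [NormedSpace ℝ F]
    {S : Set X} {N : Set (ℝ × X)} (hS : IsOpen S) (hN : IsOpen N) (hSN : Icc 0 1 ×ˢ S ⊆ N)
    {g : ℝ × X → F} (hg : ContDiffOn ℝ ∞ g N) :
    ContDiffOn ℝ ∞ (fun p => ∫ s in (0 : ℝ)..1, g (s, p)) S := by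
  rw [contDiffOn_infty]
  intro k
  induction k generalizing F with
  | zero =>
    exact contDiffOn_zero.2 fun p hp =>
      (hasFDerivAt_parametric_integral hS hN hSN hg hp).continuousAt.continuousWithinAt
  | succ k ih =>
    push_cast
    rw [contDiffOn_succ_iff_fderiv_of_isOpen hS]
    refine ⟨fun p hp => (hasFDerivAt_parametric_integral hS hN hSN hg
      hp).differentiableAt.differentiableWithinAt, by simp, ?_⟩
    refine (ih ((hg.fderiv_of_isOpen (m := ∞) hN (by simp)).clm_comp
      (contDiffOn_const (c := ContinuousLinearMap.inr ℝ ℝ X)))).congr fun p hp => ?_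
    exact (hasFDerivAt_parametric_integral hS hN hSN hg hp).fderiv

end ParametricIntegral

/-! ### The homotopy operator on closed 2-forms -/

section Poincare

universe u

/-- The exterior derivative of the pullback of a closed 2-form `B` by `H`, evaluated on constant
vector fields, is zero. -/
theorem fderiv_pullback_cyclic {X Y : Type*} [NormedAddCommGroup X] [NormedSpace ℝ X]
    [NormedAddCommGroup Y] [NormedSpace ℝ Y] {B : X → X →L[ℝ] X →L[ℝ] ℝ} {H : Y → X} {q : Y}
    (hB : DifferentiableAt ℝ B (H q)) (hH : ContDiffAt ℝ ∞ H q)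
    (hanti : ∀ u v, B (H q) u v = -B (H q) v u)
    (hclosed : ∀ u v w, fderiv ℝ B (H q) u v w - fderiv ℝ B (H q) v u w
      + fderiv ℝ B (H q) w u v = 0) (z a b : Y) :
    fderiv ℝ (fun q => B (H q) (fderiv ℝ H q a) (fderiv ℝ H q b)) q z
      = fderiv ℝ (fun q => B (H q) (fderiv ℝ H q z) (fderiv ℝ H q b)) q a
      - fderiv ℝ (fun q => B (H q) (fderiv ℝ H q z) (fderiv ℝ H q a)) q b := by
  have h1 : DifferentiableAt ℝ H q := hH.differentiableAt (by simp)
  have h2 : DifferentiableAt ℝ (fderiv ℝ H) q :=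
    (hH.fderiv_right (m := ∞) (by simp)).differentiableAt (by simp)
  have h3 := hH.isSymmSndFDerivAt minSmoothness_two_le_infty
  have key : ∀ a b z : Y, fderiv ℝ (fun q => B (H q) (fderiv ℝ H q a) (fderiv ℝ H q b)) q z
      = fderiv ℝ B (H q) (fderiv ℝ H q z) (fderiv ℝ H q a) (fderiv ℝ H q b)
        + B (H q) (fderiv ℝ (fderiv ℝ H) q z a) (fderiv ℝ H q b)
        + B (H q) (fderiv ℝ H q a) (fderiv ℝ (fderiv ℝ H) q z b) := by
    intro a b z
    have h4 : ∀ c : Y, HasFDerivAt (fun q => fderiv ℝ H q c) _ q := fun c =>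
      h2.hasFDerivAt.clm_apply (hasFDerivAt_const c q)
    have h5 := ((hB.hasFDerivAt.comp q h1.hasFDerivAt).clm_apply (h4 a)).clm_apply (h4 b)
    refine (DFunLike.congr_fun h5.fderiv z).trans ?_
    simp
    ring
  rw [key, key, key, h3 a z, h3 b z, h3 b a]
  linarith [hclosed (fderiv ℝ H q z) (fderiv ℝ H q a) (fderiv ℝ H q b),
    hanti (fderiv ℝ (fderiv ℝ H) q z b) (fderiv ℝ H q a)]

/-- The Poincaré lemma for a smooth homotopy `H` from a map that pulls the closed 2-form `B` back
to zero to the identity. The primitive is the integral of `i_{∂/∂s} H^* B`. -/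
theorem exists_primitive_of_homotopy {X : Type u} [NormedAddCommGroup X] [NormedSpace ℝ X]
    [FiniteDimensional ℝ X] {S : Set X} {N : Set (ℝ × X)} (hS : IsOpen S) (hN : IsOpen N)
    (hSN : Icc 0 1 ×ˢ S ⊆ N) {B : X → X →L[ℝ] X →L[ℝ] ℝ} (hB : ContDiffOn ℝ ∞ B S)
    (hanti : ∀ p ∈ S, ∀ u v, B p u v = -B p v u)
    (hclosed : ∀ p ∈ S, ∀ u v w, fderiv ℝ B p u v w - fderiv ℝ B p v u w
      + fderiv ℝ B p w u v = 0)
    {H : ℝ × X → X} (hH : ContDiffOn ℝ ∞ H N) (hHS : MapsTo H N S) (hH1 : ∀ p ∈ S, H (1, p) = p)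
    (hH0 : ∀ p ∈ S, ∀ u v,
      B (H (0, p)) (fderiv ℝ H (0, p) (0, u)) (fderiv ℝ H (0, p) (0, v)) = 0) :
    ∃ K : X → X →L[ℝ] ℝ, ContDiffOn ℝ ∞ K S ∧
      ∀ p ∈ S, ∀ u v, fderiv ℝ K p u v - fderiv ℝ K p v u = B p u v := by
  have hdH := hH.fderiv_of_isOpen (m := ∞) hN (by simp)
  have hBH : ContDiffOn ℝ ∞ (fun q => B (H q)) N := hB.comp hH hHS
  let G : ℝ × X → ℝ × X → ℝ × X → ℝ := fun a b q => B (H q) (fderiv ℝ H q a) (fderiv ℝ H q b)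
  have hG : ∀ a b, ContDiffOn ℝ ∞ (G a b) N := fun a b =>
    (hBH.clm_apply (hdH.clm_apply contDiffOn_const)).clm_apply (hdH.clm_apply contDiffOn_const)
  let k : ℝ × X → X →L[ℝ] ℝ := fun q =>
    (B (H q) (fderiv ℝ H q (1, 0))).comp ((fderiv ℝ H q).comp (.inr ℝ ℝ X))
  have hk : ContDiffOn ℝ ∞ k N :=
    (hBH.clm_apply (hdH.clm_apply contDiffOn_const)).clm_comp (hdH.clm_comp contDiffOn_const)
  refine ⟨fun p => ∫ s in (0 : ℝ)..1, k (s, p), contDiffOn_parametric_integral hS hN hSN hk,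
    fun p hp u v => ?_⟩
  have hmem : ∀ s ∈ uIcc (0 : ℝ) 1, (s, p) ∈ N := fun s hs => by
    rw [uIcc_of_le zero_le_one] at hs
    exact hSN ⟨hs, hp⟩
  have hline : ContinuousOn (fun s : ℝ => (s, p)) (uIcc 0 1) := by fun_prop
  have hdk : ContDiffOn ℝ ∞ (fun q => (fderiv ℝ k q).comp (.inr ℝ ℝ X)) N :=
    (hk.fderiv_of_isOpen (m := ∞) hN (by simp)).clm_comp contDiffOn_const
  have hint : IntervalIntegrable (fun s => (fderiv ℝ k (s, p)).comp (.inr ℝ ℝ X))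
      MeasureTheory.volume 0 1 :=
    (hdk.continuousOn.comp hline hmem).intervalIntegrable
  have hK : ∀ u v, fderiv ℝ (fun p => ∫ s in (0 : ℝ)..1, k (s, p)) p u v
      = ∫ s in (0 : ℝ)..1, fderiv ℝ (G (1, 0) (0, v)) (s, p) (0, u) := by
    intro u v
    rw [(hasFDerivAt_parametric_integral hS hN hSN hk hp).fderiv,
      ContinuousLinearMap.intervalIntegral_apply hint,
      ContinuousLinearMap.intervalIntegral_apply]
    · refine intervalIntegral.integral_congr fun s hs => ?_
      have h1 : DifferentiableAt ℝ k (s, p) :=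
        (hk.contDiffAt (hN.mem_nhds (hmem s hs))).differentiableAt (by simp)
      have h2 := (h1.hasFDerivAt.clm_apply (hasFDerivAt_const v (s, p))).fderiv
      exact ((DFunLike.congr_fun h2 (0, u)).trans (by simp)).symm
    · exact ((hdk.clm_apply contDiffOn_const).continuousOn.comp hline hmem).intervalIntegrable
  have hcont : ∀ a b z : ℝ × X, IntervalIntegrable (fun s => fderiv ℝ (G a b) (s, p) z)
      MeasureTheory.volume 0 1 := fun a b z =>
    ((((hG a b).fderiv_of_isOpen (m := ∞) hN (by simp)).clm_apply
      contDiffOn_const).continuousOn.comp hline hmem).intervalIntegrable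
  rw [hK, hK, ← intervalIntegral.integral_sub (hcont _ _ _) (hcont _ _ _)]
  have hderiv : ∀ s ∈ uIcc (0 : ℝ) 1, HasDerivAt (fun s => G (0, u) (0, v) (s, p))
      (fderiv ℝ (G (1, 0) (0, v)) (s, p) (0, u) - fderiv ℝ (G (1, 0) (0, u)) (s, p) (0, v)) s := by
    intro s hs
    have hq := hmem s hs
    have h1 : HasDerivAt (fun s : ℝ => ((s, p) : ℝ × X)) (1, 0) s :=
      (hasDerivAt_id s).prodMk (hasDerivAt_const s p)
    have h2 : DifferentiableAt ℝ (G (0, u) (0, v)) (s, p) :=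
      ((hG _ _).contDiffAt (hN.mem_nhds hq)).differentiableAt (by simp)
    refine (h2.hasFDerivAt.comp_hasDerivAt s h1).congr_deriv ?_
    exact fderiv_pullback_cyclic
      ((hB.contDiffAt (hS.mem_nhds (hHS hq))).differentiableAt (by simp))
      (hH.contDiffAt (hN.mem_nhds hq)) (hanti _ (hHS hq)) (hclosed _ (hHS hq)) _ _ _
  rw [intervalIntegral.integral_eq_sub_of_hasDerivAt hderiv ((hcont _ _ _).sub (hcont _ _ _))]
  have hid : ∀ w, fderiv ℝ H (1, p) (0, w) = w := by
    intro w
    have h1 : DifferentiableAt ℝ H (1, p) :=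
      (hH.contDiffAt (hN.mem_nhds (hSN ⟨by simp, hp⟩))).differentiableAt (by simp)
    have h2 := h1.hasFDerivAt.comp p (hasFDerivAt_prodMk_right (1 : ℝ) p)
    have h3 := h2.unique ((hasFDerivAt_id p).congr_of_eventuallyEq
      (Filter.mem_of_superset (hS.mem_nhds hp) fun x hx => hH1 x hx))
    exact DFunLike.congr_fun h3 w
  simp only [G]
  rw [hH0 p hp, hid, hid, hH1 p hp, sub_zero]

end Poincare

/-! ### Smooth contractions -/

section Contraction

variable {E : Type*} [NormedAddCommGroup E] [NormedSpace ℝ E] [FiniteDimensional ℝ E] {V : Set E}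

/-- A contractible open set admits a smooth contraction: a continuous one, made stationary near both
ends, is approximated within the distance to the complement by means of a partition of unity. -/
theorem exists_smooth_contraction (hV : IsOpen V) (hc : ContractibleSpace V) :
    ∃ (h : ℝ × E → E) (x₀ : E), x₀ ∈ V ∧ ContDiffOn ℝ ∞ h (univ ×ˢ V) ∧
      MapsTo h (univ ×ˢ V) V ∧ (∀ x ∈ V, h (1, x) = x) ∧ ∀ x ∈ V, h (0, x) = x₀ := by
  -- The distance to the complement is a junk value when the complement is empty.
  rcases eq_or_ne V univ with rfl | hne
  · exact ⟨fun q => q.1 • q.2, 0, mem_univ _, contDiffOn_fst.smul contDiffOn_snd,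
      fun _ _ => mem_univ _, by simp, by simp⟩
  have hne' : (Vᶜ).Nonempty := nonempty_compl.2 hne
  obtain ⟨⟨x₀, hx₀⟩, ⟨F⟩⟩ := id_nullhomotopic V
  let W : TopologicalSpace.Opens (ℝ × E) := ⟨univ ×ˢ V, isOpen_univ.prod hV⟩
  have hlc : LocallyCompactSpace W := W.isOpen.locallyCompactSpace
  -- The contraction, with time reversed, is run over `[1/3, 2/3]` and stationary outside.
  let f : W → E := fun q => F (projIcc 0 1 zero_le_one (2 - 3 * q.1.1), ⟨q.1.2, q.2.2⟩)
  have hf : Continuous f := by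
    refine continuous_subtype_val.comp (F.continuous.comp (Continuous.prodMk ?_ ?_))
    · exact continuous_projIcc.comp (by fun_prop)
    · exact Continuous.subtype_mk (by fun_prop) _
  have hfV : ∀ q, f q ∈ V := fun q => Subtype.coe_prop _
  have hf1 : ∀ q : W, 2 / 3 < q.1.1 → f q = q.1.2 := by
    intro q hq
    have : projIcc (0 : ℝ) 1 zero_le_one (2 - 3 * q.1.1) = 0 :=
      projIcc_of_le_left _ (by linarith)
    simp [f, this]
  have hf0 : ∀ q : W, q.1.1 < 1 / 3 → f q = x₀ := by
    intro q hq
    have : projIcc (0 : ℝ) 1 zero_le_one (2 - 3 * q.1.1) = 1 :=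
      projIcc_of_right_le _ (by linarith)
    simp [f, this]
  let δ : W → ℝ := fun q => Metric.infDist (f q) Vᶜ
  have hδ : Continuous δ := (Metric.continuous_infDist_pt _).comp hf
  have hδpos : ∀ q, 0 < δ q := fun q =>
    (hV.isClosed_compl.notMem_iff_infDist_pos hne').1 (fun hq => hq (hfV q))
  -- The approximation has to agree with `f` exactly for `s ≥ 3/4` and for `s ≤ 1/4`.
  let t : W → Set E := fun q => Metric.ball (f q) (δ q) ∩
    ((⋂ _ : 3 / 4 ≤ q.1.1, {q.1.2}) ∩ (⋂ _ : q.1.1 ≤ 1 / 4, {x₀}))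
  have ht : ∀ q, Convex ℝ (t q) := fun q => (convex_ball _ _).inter
    ((convex_iInter fun _ => convex_singleton _).inter (convex_iInter fun _ => convex_singleton _))
  have hmem : ∀ q z, z ∈ t q ↔
      dist z (f q) < δ q ∧ (3 / 4 ≤ q.1.1 → z = q.1.2) ∧ (q.1.1 ≤ 1 / 4 → z = x₀) := by
    intro q z
    simp [t]
  have hfst : Continuous fun q : W => q.1.1 := by fun_prop
  obtain ⟨g, hg⟩ := exists_contMDiffMap_forall_mem_convex_of_local (n := ⊤) 𝓘(ℝ, ℝ × E) ht (by
    intro q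
    rcases lt_or_ge (2 / 3) q.1.1 with h1 | h1
    · refine ⟨{q | 2 / 3 < q.1.1}, (isOpen_lt continuous_const hfst).mem_nhds h1,
        fun q => q.1.2, ?_, fun r hr => (hmem _ _).2 ⟨?_, fun _ => rfl, fun h => ?_⟩⟩
      · exact (contDiff_snd.contMDiff.comp contMDiff_subtype_val).contMDiffOn
      · rw [hf1 r hr, dist_self]
        exact hδpos r
      · have hr' : 2 / 3 < r.1.1 := hr
        linarith
    rcases lt_or_ge q.1.1 (1 / 3) with h2 | h2
    · refine ⟨{q | q.1.1 < 1 / 3}, (isOpen_lt hfst continuous_const).mem_nhds h2,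
        fun q => x₀, contMDiffOn_const, fun r hr => (hmem _ _).2 ⟨?_, fun h => ?_, fun _ => rfl⟩⟩
      · rw [hf0 r hr, dist_self]
        exact hδpos r
      · have hr' : r.1.1 < 1 / 3 := hr
        linarith
    · refine ⟨{r | (1 / 4 < r.1.1 ∧ r.1.1 < 3 / 4) ∧ dist (f q) (f r) < δ r},
        (((isOpen_lt continuous_const hfst).inter (isOpen_lt hfst continuous_const)).inter
          (isOpen_lt (continuous_const.dist hf) hδ)).mem_nhds ?_,
        fun _ => f q, contMDiffOn_const, fun r hr => (hmem _ _).2 ⟨hr.2, fun h => ?_, fun h => ?_⟩⟩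
      · refine ⟨⟨?_, ?_⟩, ?_⟩
        · change 1 / 4 < q.1.1
          linarith
        · change q.1.1 < 3 / 4
          linarith
        · change dist (f q) (f q) < δ q
          rw [dist_self]
          exact hδpos q
      · linarith [hr.1.2]
      · linarith [hr.1.1])
  classical
  let h : ℝ × E → E := fun q => if hq : q ∈ W then g ⟨q, hq⟩ else 0
  have hh : ∀ q : W, h q = g q := fun q => dif_pos q.2
  refine ⟨h, x₀, hx₀, ?_, ?_, ?_, ?_⟩
  · intro q hq
    have h1 : ContMDiffAt 𝓘(ℝ, ℝ × E) 𝓘(ℝ, E) ∞ (fun r : W => h r) ⟨q, hq⟩ := by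
      simp only [hh]
      exact g.contMDiff.contMDiffAt
    exact (contMDiffAt_iff_contDiffAt.1 (contMDiffAt_subtype_iff.1 h1)).contDiffWithinAt
  · intro q hq
    have h1 := ((hmem _ _).1 (hg ⟨q, hq⟩)).1
    rw [← hh] at h1
    exact Metric.ball_infDist_compl_subset h1
  · intro x hx
    exact (hh ⟨(1, x), ⟨mem_univ _, hx⟩⟩).trans
      (((hmem _ _).1 (hg ⟨(1, x), ⟨mem_univ _, hx⟩⟩)).2.1 (by norm_num))
  · intro x hx
    exact (hh ⟨(0, x), ⟨mem_univ _, hx⟩⟩).trans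
      (((hmem _ _).1 (hg ⟨(0, x), ⟨mem_univ _, hx⟩⟩)).2.2 (by norm_num))

end Contraction

/-! ### Closed 1-forms along the fibres -/

section FibrePrimitive

variable {E : Type} [NormedAddCommGroup E] [InnerProductSpace ℝ E] {V : Set E}

/-- The part of the slit tangent bundle over `V` where `y` is not a nonpositive multiple of `e`. In
each fibre it is star-shaped with centre `e`, and stating the condition as strictness in the
Cauchy–Schwarz inequality makes it visibly open. -/
def rayComplement (V : Set E) (e : E) : Set (E × E) :=
  {p | p.1 ∈ V ∧ -(‖e‖ * ‖p.2‖) < inner ℝ e p.2}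

theorem isOpen_rayComplement (hV : IsOpen V) (e : E) : IsOpen (rayComplement V e) :=
  (hV.preimage continuous_fst).inter
    (isOpen_lt (continuous_const.mul continuous_snd.norm).neg
      (continuous_const.inner continuous_snd))

theorem segment_mem_slit {e : E} (he : e ≠ 0) {p : E × E} (hp : p ∈ rayComplement V e) {s : ℝ}
    (hs : s ∈ Icc (0 : ℝ) 1) : (p.1, e + s • (p.2 - e)) ∈ slit V := by
  refine ⟨hp.1, fun h0 => ?_⟩
  have h0' : e + s • (p.2 - e) = 0 := h0
  have hsy : s • p.2 = -((1 - s) • e) := by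
    rw [smul_sub] at h0'
    rw [sub_smul, one_smul]
    rw [← sub_eq_zero, ← h0']
    abel
  rcases hs.1.eq_or_lt with rfl | hs0
  · simp at h0'
    exact he h0'
  have h1 : s * inner ℝ e p.2 = -((1 - s) * ‖e‖ ^ 2) := by
    rw [← real_inner_smul_right, hsy, inner_neg_right, real_inner_smul_right,
      real_inner_self_eq_norm_sq]
  have h2 : s * ‖p.2‖ = (1 - s) * ‖e‖ := by
    have := congrArg norm hsy
    rwa [norm_neg, norm_smul, norm_smul, Real.norm_of_nonneg hs.1,
      Real.norm_of_nonneg (by linarith [hs.2])] at this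
  have h3 : 0 < s * (inner ℝ e p.2 + ‖e‖ * ‖p.2‖) := mul_pos hs0 (by linarith [hp.2])
  have h4 : s * (inner ℝ e p.2 + ‖e‖ * ‖p.2‖) = 0 := by
    linear_combination h1 + ‖e‖ * h2
  linarith

/-- The derivative of `s K(0, w)` along the segment from `e` to `y`. For `K` closed along the fibres
it is the derivative with respect to the endpoint `y` of the integrand `K(0, y - e)`, given in
`hasDerivAt_segment_endpoint`. -/
theorem hasDerivAt_mul_along_segment {K : E × E → E × E →L[ℝ] ℝ} {x y e w : E} {s : ℝ}
    (hK : DifferentiableAt ℝ K (x, e + s • (y - e))) :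
    HasDerivAt (fun s : ℝ => s * K (x, e + s • (y - e)) (0, w))
      (K (x, e + s • (y - e)) (0, w)
        + s * fderiv ℝ K (x, e + s • (y - e)) (0, y - e) (0, w)) s := by
  have h0 : HasDerivAt (fun s : ℝ => e + s • (y - e)) (y - e) s := by
    simpa using ((hasDerivAt_id' s).smul_const (y - e)).const_add e
  have h1 : HasDerivAt (fun s : ℝ => K (x, e + s • (y - e)))
      (fderiv ℝ K (x, e + s • (y - e)) (0, y - e)) s :=
    hK.hasFDerivAt.comp_hasDerivAt s ((hasDerivAt_const s x).prodMk h0)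
  have h2 : HasDerivAt (fun s : ℝ => K (x, e + s • (y - e)) (0, w))
      (fderiv ℝ K (x, e + s • (y - e)) (0, y - e) (0, w)) s :=
    (h1.clm_apply (hasDerivAt_const s ((0, w) : E × E))).congr_deriv (by simp)
  exact ((hasDerivAt_id' s).mul h2).congr_deriv (by simp)

theorem hasDerivAt_segment_endpoint {K : E × E → E × E →L[ℝ] ℝ} {x y e w : E} {s : ℝ}
    (hK : DifferentiableAt ℝ K (x, e + s • (y - e))) :
    HasDerivAt (fun r : ℝ => K (x, e + s • (y + r • w - e)) (0, y + r • w - e))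
      (s * fderiv ℝ K (x, e + s • (y - e)) (0, w) (0, y - e)
        + K (x, e + s • (y - e)) (0, w)) 0 := by
  have h0 : HasDerivAt (fun r : ℝ => y + r • w - e) w 0 := by
    simpa using (((hasDerivAt_id' (0 : ℝ)).smul_const w).const_add y).sub_const e
  have h1 : HasDerivAt (fun r : ℝ => ((x, e + s • (y + r • w - e)) : E × E)) (0, s • w) 0 :=
    (hasDerivAt_const (0 : ℝ) x).prodMk ((h0.const_smul s).const_add e)
  have h2 : HasDerivAt (fun r : ℝ => K (x, e + s • (y + r • w - e)))
      (fderiv ℝ K (x, e + s • (y - e)) (0, s • w)) 0 :=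
    hK.hasFDerivAt.comp_hasDerivAt_of_eq (0 : ℝ) h1 (by simp)
  have h3 : HasDerivAt (fun r : ℝ => ((0, y + r • w - e) : E × E)) (0, w) 0 :=
    (hasDerivAt_const (0 : ℝ) (0 : E)).prodMk h0
  have h4 : ((0, s • w) : E × E) = s • (0, w) := by simp
  refine (h2.clm_apply h3).congr_deriv ?_
  rw [h4, map_smul]
  simp

/-- On the complement of a ray, a closed 1-form along the fibres has a smooth primitive, its
integral along the segments from `e`. -/
theorem exists_fibre_primitive_rayComplement [FiniteDimensional ℝ E] (hV : IsOpen V) {e : E}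
    (he : e ≠ 0) {K : E × E → E × E →L[ℝ] ℝ} (hK : ContDiffOn ℝ ∞ K (slit V))
    (hcl : ∀ p ∈ slit V, ∀ a b : E, fderiv ℝ K p (0, a) (0, b) = fderiv ℝ K p (0, b) (0, a)) :
    ∃ f : E × E → ℝ, ContDiffOn ℝ ∞ f (rayComplement V e) ∧
      ∀ p ∈ rayComplement V e, ∀ w : E, fderiv ℝ f p (0, w) = K p (0, w) := by
  let m : ℝ × (E × E) → E × E := fun q => (q.2.1, e + q.1 • (q.2.2 - e))
  have hm : ContDiff ℝ ∞ m := by fun_prop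
  let N : Set (ℝ × (E × E)) := m ⁻¹' slit V
  have hN : IsOpen N := (isOpen_slit hV).preimage hm.continuous
  have hSN : Icc (0 : ℝ) 1 ×ˢ rayComplement V e ⊆ N := fun q hq => segment_mem_slit he hq.2 hq.1
  let g : ℝ × (E × E) → ℝ := fun q => K (m q) (0, q.2.2 - e)
  have hg : ContDiffOn ℝ ∞ g N :=
    (hK.comp hm.contDiffOn (mapsTo_preimage _ _)).clm_apply
      (ContDiff.contDiffOn (by fun_prop))
  refine ⟨fun p => ∫ s in (0 : ℝ)..1, g (s, p),
    contDiffOn_parametric_integral (isOpen_rayComplement hV e) hN hSN hg, fun p hp w => ?_⟩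
  have hmem : ∀ s ∈ uIcc (0 : ℝ) 1, (s, p) ∈ N := fun s hs => by
    rw [uIcc_of_le zero_le_one] at hs
    exact hSN ⟨hs, hp⟩
  have hline : ContinuousOn (fun s : ℝ => (s, p)) (uIcc 0 1) := by fun_prop
  have hdg : ContDiffOn ℝ ∞ (fun q => (fderiv ℝ g q).comp (.inr ℝ ℝ (E × E))) N :=
    (hg.fderiv_of_isOpen (m := ∞) hN (by simp)).clm_comp contDiffOn_const
  have hint : IntervalIntegrable (fun s => (fderiv ℝ g (s, p)).comp (.inr ℝ ℝ (E × E)))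
      MeasureTheory.volume 0 1 :=
    (hdg.continuousOn.comp hline hmem).intervalIntegrable
  rw [(hasFDerivAt_parametric_integral (isOpen_rayComplement hV e) hN hSN hg hp).fderiv,
    ContinuousLinearMap.intervalIntegral_apply hint]
  -- The integrand is the derivative of `s ↦ s K (0, w)` along the segment.
  have hderiv : ∀ s ∈ uIcc (0 : ℝ) 1, HasDerivAt (fun s => s * K (m (s, p)) (0, w))
      ((fderiv ℝ g (s, p)).comp (.inr ℝ ℝ (E × E)) (0, w)) s := by
    intro s hs
    have hq := hmem s hs
    have hKd : DifferentiableAt ℝ K (m (s, p)) :=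
      (hK.contDiffAt ((isOpen_slit hV).mem_nhds hq)).differentiableAt (by simp)
    have h1 : HasDerivAt (fun r : ℝ => ((s, (p.1, p.2 + r • w)) : ℝ × (E × E)))
        (0, ((0, w) : E × E)) 0 :=
      (hasDerivAt_const (0 : ℝ) s).prodMk ((hasDerivAt_const (0 : ℝ) p.1).prodMk (by
        simpa using ((hasDerivAt_id' (0 : ℝ)).smul_const w).const_add p.2))
    have hgd : DifferentiableAt ℝ g (s, p) :=
      (hg.contDiffAt (hN.mem_nhds hq)).differentiableAt (by simp)
    have h2 := hgd.hasFDerivAt.comp_hasDerivAt_of_eq (0 : ℝ) h1 (by simp)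
    refine (hasDerivAt_mul_along_segment hKd).congr_deriv ?_
    rw [hcl _ hq, add_comm]
    exact (h2.unique (hasDerivAt_segment_endpoint hKd)).symm
  rw [intervalIntegral.integral_eq_sub_of_hasDerivAt hderiv]
  · simp [m]
  · exact ((hdg.clm_apply contDiffOn_const).continuousOn.comp hline hmem).intervalIntegrable

theorem mem_rayComplement_of_notMem_span {e y : E} (he : e ≠ 0)
    (hy : y ∉ Submodule.span ℝ {e}) {x : E} (hx : x ∈ V) : (x, y) ∈ rayComplement V e := by
  refine ⟨hx, lt_of_le_of_ne (neg_le_of_abs_le (abs_real_inner_le_norm e y)) fun h => hy ?_⟩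
  have h1 : inner ℝ (-e) y = ‖-e‖ * ‖y‖ := by
    rw [inner_neg_left, norm_neg, ← h, neg_neg]
  have h2 := inner_eq_norm_mul_iff_real.1 h1
  rw [norm_neg] at h2
  refine Submodule.mem_span_singleton.2 ⟨-(‖e‖⁻¹ * ‖y‖), ?_⟩
  rw [neg_smul, mul_smul, ← smul_neg, ← smul_neg, h2, smul_smul,
    inv_mul_cancel₀ (norm_ne_zero_iff.2 he), one_smul]

theorem notMem_span_of_mem_rayComplement {e : E} {p : E × E} (h : p ∈ rayComplement V e)
    (h' : p ∈ rayComplement V (-e)) : p.2 ∉ Submodule.span ℝ {e} := by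
  intro hp
  obtain ⟨k, hk⟩ := Submodule.mem_span_singleton.1 hp
  have h1 := h.2
  have h2 := h'.2
  rw [← hk, norm_smul, real_inner_smul_right, real_inner_self_eq_norm_sq, Real.norm_eq_abs] at h1
  rw [← hk, norm_smul, inner_neg_left, norm_neg, real_inner_smul_right,
    real_inner_self_eq_norm_sq, Real.norm_eq_abs] at h2
  rcases abs_cases k with ⟨h3, _⟩ | ⟨h3, _⟩ <;> rw [h3] at h1 h2 <;> nlinarith

/-- In dimension at least 3 the punctured fibres are simply connected, so a closed 1-form along
them has a smooth primitive. The primitives over the complements of two opposite rays differ, over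
the complement of a line, by a function of `x` only, because the latter is connected. -/
theorem exists_fibre_primitive [FiniteDimensional ℝ E] (hdim : 2 < Module.finrank ℝ E)
    (hV : IsOpen V) {K : E × E → E × E →L[ℝ] ℝ} (hK : ContDiffOn ℝ ∞ K (slit V))
    (hcl : ∀ p ∈ slit V, ∀ a b : E, fderiv ℝ K p (0, a) (0, b) = fderiv ℝ K p (0, b) (0, a)) :
    ∃ f : E × E → ℝ, ContDiffOn ℝ ∞ f (slit V) ∧
      ∀ p ∈ slit V, ∀ w : E, fderiv ℝ f p (0, w) = K p (0, w) := by
  have : Nontrivial E := Module.nontrivial_of_finrank_pos (R := ℝ) (by omega)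
  obtain ⟨e, he⟩ := exists_ne (0 : E)
  have hcodim : 1 < Module.rank ℝ (E ⧸ Submodule.span ℝ {e}) := by
    have h1 := Submodule.finrank_quotient_add_finrank (Submodule.span ℝ {e})
    rw [finrank_span_singleton he] at h1
    have h2 := Module.lt_rank_of_lt_finrank (R := ℝ) (M := E ⧸ Submodule.span ℝ {e}) (n := 1)
      (by omega)
    exact_mod_cast h2
  have hconn := isConnected_compl_of_one_lt_codim hcodim
  obtain ⟨y₁, hy₁⟩ := hconn.nonempty
  obtain ⟨f, hf, hf'⟩ := exists_fibre_primitive_rayComplement hV he hK hcl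
  obtain ⟨g, hg, hg'⟩ := exists_fibre_primitive_rayComplement hV (neg_ne_zero.2 he) hK hcl
  have hO := isOpen_rayComplement hV e
  have hO' := isOpen_rayComplement hV (-e)
  have hmem : ∀ x ∈ V, ∀ y ∈ ((Submodule.span ℝ {e} : Submodule ℝ E) : Set E)ᶜ,
      (x, y) ∈ rayComplement V e ∧ (x, y) ∈ rayComplement V (-e) := by
    intro x hx y hy
    refine ⟨mem_rayComplement_of_notMem_span he hy hx,
      mem_rayComplement_of_notMem_span (neg_ne_zero.2 he) ?_ hx⟩
    rwa [← Set.neg_singleton, Submodule.span_neg]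
  let c : E → ℝ := fun x => f (x, y₁) - g (x, y₁)
  have hc : ContDiffOn ℝ ∞ c V := by
    have h1 : ContDiffOn ℝ ∞ (fun x : E => (x, y₁)) V := ContDiff.contDiffOn (by fun_prop)
    exact (hf.comp h1 fun x hx => (hmem x hx y₁ hy₁).1).sub
      (hg.comp h1 fun x hx => (hmem x hx y₁ hy₁).2)
  have hcompl : IsOpen (((Submodule.span ℝ {e} : Submodule ℝ E) : Set E)ᶜ) :=
    (Submodule.closed_of_finiteDimensional _).isOpen_compl
  have hconst : ∀ p, p ∈ rayComplement V e → p ∈ rayComplement V (-e) → f p = g p + c p.1 := by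
    rintro ⟨x, y⟩ hp hp'
    have hy := notMem_span_of_mem_rayComplement hp hp'
    have hd : ∀ z ∈ ((Submodule.span ℝ {e} : Submodule ℝ E) : Set E)ᶜ,
        HasFDerivAt (fun z => f (x, z) - g (x, z)) (0 : E →L[ℝ] ℝ) z := by
      intro z hz
      obtain ⟨hz1, hz2⟩ := hmem x hp.1 z hz
      have h1 := ((hf.contDiffAt (hO.mem_nhds hz1)).differentiableAt
        (by simp)).hasFDerivAt.comp z (hasFDerivAt_prodMk_right x z)
      have h2 := ((hg.contDiffAt (hO'.mem_nhds hz2)).differentiableAt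
        (by simp)).hasFDerivAt.comp z (hasFDerivAt_prodMk_right x z)
      refine (h1.sub h2).congr_fderiv ?_
      ext w
      change fderiv ℝ f (x, z) (0, w) - fderiv ℝ g (x, z) (0, w) = 0
      rw [hf' _ hz1, hg' _ hz2, sub_self]
    have h := hcompl.is_const_of_fderiv_eq_zero (𝕜 := ℝ) hconn.isPreconnected
      (fun z hz => (hd z hz).differentiableAt.differentiableWithinAt)
      (fun z hz => (hd z hz).fderiv) hy hy₁
    simp only [c]
    linarith
  classical
  let F : E × E → ℝ := fun p => if p ∈ rayComplement V e then f p else g p + c p.1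
  have hF1 : ∀ p ∈ rayComplement V e, F =ᶠ[𝓝 p] f := fun p hp =>
    Filter.mem_of_superset (hO.mem_nhds hp) fun q hq => if_pos hq
  have hF2 : ∀ p ∈ rayComplement V (-e), F =ᶠ[𝓝 p] fun q => g q + c q.1 := fun p hp =>
    Filter.mem_of_superset (hO'.mem_nhds hp) fun q hq => by
      by_cases hq' : q ∈ rayComplement V e
      · exact (if_pos hq').trans (hconst q hq' hq)
      · exact if_neg hq'
  have hcover : ∀ p ∈ slit V, p ∈ rayComplement V e ∨ p ∈ rayComplement V (-e) := by
    rintro p ⟨h1, h2⟩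
    by_cases h3 : -(‖e‖ * ‖p.2‖) < inner ℝ e p.2
    · exact Or.inl ⟨h1, h3⟩
    · refine Or.inr ⟨h1, ?_⟩
      have h4 : 0 < ‖e‖ * ‖p.2‖ := mul_pos (norm_pos_iff.2 he) (norm_pos_iff.2 h2)
      rw [norm_neg, inner_neg_left]
      linarith
  have hcd : ∀ p ∈ slit V, ContDiffAt ℝ ∞ (fun q : E × E => c q.1) p := fun p hp =>
    (hc.contDiffAt (hV.mem_nhds hp.1)).comp p contDiffAt_fst
  refine ⟨F, fun p hp => ContDiffAt.contDiffWithinAt ?_, fun p hp w => ?_⟩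
  · rcases hcover p hp with h | h
    · exact (hf.contDiffAt (hO.mem_nhds h)).congr_of_eventuallyEq (hF1 p h)
    · exact ((hg.contDiffAt (hO'.mem_nhds h)).add (hcd p hp)).congr_of_eventuallyEq (hF2 p h)
  · rcases hcover p hp with h | h
    · rw [(hF1 p h).fderiv_eq, hf' p h]
    · have h1 := ((hg.contDiffAt (hO'.mem_nhds h)).differentiableAt (by simp)).hasFDerivAt
      have h2 := ((hc.contDiffAt (hV.mem_nhds hp.1)).differentiableAt
        (by simp)).hasFDerivAt.comp p hasFDerivAt_fst
      rw [(hF2 p h).fderiv_eq]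
      refine (DFunLike.congr_fun (h1.add h2).fderiv (0, w)).trans ?_
      simp [hg' p h]

end FibrePrimitive

/-! ### The four properties make the form closed -/

section Closed

variable {E : Type*} [NormedAddCommGroup E] [NormedSpace ℝ E] {V : Set E}
  {Γ : E × E → E × E} {Ω : E × E → (E × E) [⋀^Fin 2]→L[ℝ] ℝ}

/-- The Lie derivative of `dΩ` along the spray is zero: `i_Γ Ω = 0` and `ℒ_Γ Ω = 0` give
`i_Γ dΩ = 0`, and `dΩ` is closed. -/
theorem HasHilbertProperties.lieDeriv_extDeriv_eq_zero (h : HasHilbertProperties V Γ Ω)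
    (hV : IsOpen V) (hΓ : IsSprayOn V Γ) {p : E × E} (hp : p ∈ slit V) (u v w : E × E) :
    trilin (fderiv ℝ (extDeriv Ω) p (Γ p)) u v w + trilin (extDeriv Ω p) (fderiv ℝ Γ p u) v w
      + trilin (extDeriv Ω p) u (fderiv ℝ Γ p v) w
      + trilin (extDeriv Ω p) u v (fderiv ℝ Γ p w) = 0 := by
  have hS := isOpen_slit hV
  have hiΓ : ∀ q ∈ slit V, ∀ v, bilin (Ω q) (Γ q) v = 0 := fun q hq =>
    mem_characteristicDistribution.1
      (h.distribution_le q hq (Submodule.subset_span (by simp)))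
  have hiΦ : ∀ q ∈ slit V, ∀ v w, trilin (extDeriv Ω q) (Γ q) v w = 0 := fun q hq v w => by
    rw [cartan_two ((h.smooth.contDiffAt (hS.mem_nhds hq)).differentiableAt (by simp))
      (hΓ.differentiableAt hV hq) (Filter.mem_of_superset (hS.mem_nhds hq) hiΓ), ← lieDeriv_eq]
    exact h.lieDeriv_eq_zero q hq v w
  exact cartan_three
    (((contDiffOn_extDeriv hS h.smooth).contDiffAt (hS.mem_nhds hp)).differentiableAt (by simp))
    (hΓ.differentiableAt hV hp) (Filter.mem_of_superset (hS.mem_nhds hp) hiΦ)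
    (extDeriv_extDeriv_apply (h.smooth.contDiffAt (hS.mem_nhds hp)) minSmoothness_two_le_infty)
    u v w

theorem bilin_fderiv_eq_zero {X : Type*} [NormedAddCommGroup X] [NormedSpace ℝ X]
    {Ω : X → X [⋀^Fin 2]→L[ℝ] ℝ} {S : Set X} (hS : IsOpen S) (hΩ : ContDiffOn ℝ ∞ Ω S) {u v : X}
    (h : ∀ q ∈ S, bilin (Ω q) u v = 0) {p : X} (hp : p ∈ S) (z : X) :
    bilin (fderiv ℝ Ω p z) u v = 0 := by
  have h0 := ((hΩ.contDiffAt (hS.mem_nhds hp)).differentiableAt (by simp)).hasFDerivAt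
  have h1 := (((bilin (X := X)).hasFDerivAt.comp p h0).clm_apply
    (hasFDerivAt_const u p)).clm_apply (hasFDerivAt_const v p)
  have h2 := h1.unique ((hasFDerivAt_const (0 : ℝ) p).congr_of_eventuallyEq
    (Filter.mem_of_superset (hS.mem_nhds hp) h))
  simpa using DFunLike.congr_fun h2 z

theorem trilin_fderiv_eq_zero {X : Type*} [NormedAddCommGroup X] [NormedSpace ℝ X]
    {Φ : X → X [⋀^Fin 3]→L[ℝ] ℝ} {S : Set X} (hS : IsOpen S) (hΦ : ContDiffOn ℝ ∞ Φ S) {u v w : X}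
    (h : ∀ q ∈ S, trilin (Φ q) u v w = 0) {p : X} (hp : p ∈ S) (z : X) :
    trilin (fderiv ℝ Φ p z) u v w = 0 := by
  have h0 := ((hΦ.contDiffAt (hS.mem_nhds hp)).differentiableAt (by simp)).hasFDerivAt
  have h1 := ((((trilin (X := X)).hasFDerivAt.comp p h0).clm_apply
    (hasFDerivAt_const u p)).clm_apply (hasFDerivAt_const v p)).clm_apply (hasFDerivAt_const w p)
  have h2 := h1.unique ((hasFDerivAt_const (0 : ℝ) p).congr_of_eventuallyEq
    (Filter.mem_of_superset (hS.mem_nhds hp) h))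
  simpa using DFunLike.congr_fun h2 z

theorem IsSprayOn.fst_fderiv (hΓ : IsSprayOn V Γ) (hV : IsOpen V) {p : E × E} (hp : p ∈ slit V)
    (z : E × E) : (fderiv ℝ Γ p z).1 = z.2 := by
  have h1 := (hΓ.differentiableAt hV hp).hasFDerivAt.fst.unique
    (hasFDerivAt_snd.congr_of_eventuallyEq
      (Filter.mem_of_superset ((isOpen_slit hV).mem_nhds hp) hΓ.second_order))
  exact DFunLike.congr_fun h1 z

theorem HasHilbertProperties.trilin_extDeriv_vertical_vertical (h : HasHilbertProperties V Γ Ω)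
    (hV : IsOpen V) {p : E × E} (hp : p ∈ slit V) (u : E × E) (b c : E) :
    trilin (extDeriv Ω p) u (0, b) (0, c) = 0 := by
  have hz : ∀ (z : E × E) (b c : E), bilin (fderiv ℝ Ω p z) (0, b) (0, c) = 0 := fun z b c =>
    bilin_fderiv_eq_zero (isOpen_slit hV) h.smooth
      (fun q hq => (bilin_apply _ _ _).trans (h.vertical q hq b c)) hp z
  have h1 : u = horizontalLift Γ p u.1 + (0, u.2 - (horizontalLift Γ p u.1).2) := by
    ext1 <;> simp [horizontalLift]
  have h2 := h.extDeriv_eq_zero p hp u.1 b c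
  rw [← trilin_apply] at h2
  rw [h1, map_add, add_apply, add_apply, h2, trilin_extDeriv, hz, hz, hz]
  simp

/-- The contraction of `dΩ` with a vertical vector is zero. As `DΓ (0, a) = (a, *)`, the Lie
derivative makes `dΩ`, evaluated on a vertical and two horizontal vectors, a trilinear form
symmetric in the first two arguments and skew in the last two; such a form is zero. -/
theorem HasHilbertProperties.trilin_extDeriv_vertical (h : HasHilbertProperties V Γ Ω)
    (hV : IsOpen V) (hΓ : IsSprayOn V Γ) {p : E × E} (hp : p ∈ slit V) (a : E) (u w : E × E) :
    trilin (extDeriv Ω p) (0, a) u w = 0 := by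
  have hS := isOpen_slit hV
  have hL := h.lieDeriv_extDeriv_eq_zero hV hΓ hp
  have hvv : ∀ q ∈ slit V, ∀ (a b : E) (w : E × E), trilin (extDeriv Ω q) (0, a) (0, b) w = 0 :=
    fun q hq a b w => by
      rw [trilin_swap_right, trilin_swap_left, h.trilin_extDeriv_vertical_vertical hV hq]
      simp
  have hDvv : ∀ (a b : E) (w : E × E),
      trilin (fderiv ℝ (extDeriv Ω) p (Γ p)) (0, a) (0, b) w = 0 := fun a b w =>
    trilin_fderiv_eq_zero hS (contDiffOn_extDeriv hS h.smooth) (fun q hq => hvv q hq a b w) hp _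
  specialize hvv p hp
  generalize hT : trilin (extDeriv Ω p) = T at *
  have hsl : ∀ u v w, T u v w = -T v u w := hT ▸ trilin_swap_left _
  have hsr : ∀ u v w, T u v w = -T u w v := hT ▸ trilin_swap_right _
  have hsplit : ∀ u : E × E, u = (u.1, 0) + (0, u.2) := fun u => by simp
  have hvv2 : ∀ (a b : E) (w : E × E), T (0, a) w (0, b) = 0 := fun a b w => by
    rw [hsr, hvv, neg_zero]
  -- `T (0, a) u w` depends only on the base components of `u` and `w`.
  have hbase : ∀ (a : E) (u w : E × E), T (0, a) u w = T (0, a) (u.1, 0) (w.1, 0) := by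
    intro a u w
    conv_lhs => rw [hsplit u, hsplit w]
    simp only [map_add, add_apply, hvv, hvv2, add_zero]
  have hsymm : ∀ a b c : E, T (0, a) (b, 0) (c, 0) = T (0, b) (a, 0) (c, 0) := by
    intro a b c
    have h1 := hL (0, a) (0, b) (c, 0)
    rw [hDvv, hvv, hsl (fderiv ℝ Γ p (0, a)), hbase b, hbase a, hΓ.fst_fderiv hV hp,
      hΓ.fst_fderiv hV hp] at h1
    linarith
  rw [hbase]
  linarith [hsymm a u.1 w.1, hsr (0, u.1) (a, 0) (w.1, 0), hsymm u.1 w.1 a,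
    hsr (0, w.1) (u.1, 0) (a, 0), hsymm w.1 a u.1, hsr (0, a) (w.1, 0) (u.1, 0)]

/-- The four properties force `dΩ = 0`: the Lie derivative takes the vanishing on a vertical vector
`(0, a)` to the vanishing on `DΓ (0, a) = (a, *)`. -/
theorem HasHilbertProperties.trilin_extDeriv_eq_zero (h : HasHilbertProperties V Γ Ω)
    (hV : IsOpen V) (hΓ : IsSprayOn V Γ) {p : E × E} (hp : p ∈ slit V) (u v w : E × E) :
    trilin (extDeriv Ω p) u v w = 0 := by
  have hS := isOpen_slit hV
  have hv : ∀ q ∈ slit V, ∀ (a : E) (v w : E × E), trilin (extDeriv Ω q) (0, a) v w = 0 :=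
    fun q hq a v w => h.trilin_extDeriv_vertical hV hΓ hq a v w
  have hu : u = fderiv ℝ Γ p (0, u.1) + (0, u.2 - (fderiv ℝ Γ p (0, u.1)).2) := by
    ext1 <;> simp [hΓ.fst_fderiv hV hp]
  have h1 := h.lieDeriv_extDeriv_eq_zero hV hΓ hp (0, u.1) v w
  rw [hv p hp, hv p hp, trilin_fderiv_eq_zero hS (contDiffOn_extDeriv hS h.smooth)
    (fun q hq => hv q hq u.1 v w) hp] at h1
  rw [hu, map_add, add_apply, add_apply, hv p hp]
  linarith

end Closed

/-! ### From a closed 2-form to a pseudo-Finsler function -/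

section Reconstruction

/-- Over a contractible set, a closed 2-form on the slit tangent bundle that vanishes on pairs of
vertical vectors has a horizontal primitive. The contraction of the base gives a primitive, because
it ends in a fibre, where the form vanishes; subtracting the differential of a primitive along the
fibres makes it horizontal. -/
theorem exists_horizontal_primitive {E : Type} [NormedAddCommGroup E] [InnerProductSpace ℝ E]
    [FiniteDimensional ℝ E] (hdim : 2 < Module.finrank ℝ E) {V : Set E} (hV : IsOpen V)
    (hc : ContractibleSpace V) {Ω : E × E → (E × E) [⋀^Fin 2]→L[ℝ] ℝ}
    (hΩ : ContDiffOn ℝ ∞ Ω (slit V)) (hclosed : ∀ p ∈ slit V, ∀ u v w,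
      trilin (extDeriv Ω p) u v w = 0)
    (hvert : ∀ p ∈ slit V, ∀ a b : E, bilin (Ω p) (0, a) (0, b) = 0) :
    ∃ θ : E × E → E × E →L[ℝ] ℝ, ContDiffOn ℝ ∞ θ (slit V) ∧
      (∀ p ∈ slit V, ∀ w : E, θ p (0, w) = 0) ∧
      ∀ p ∈ slit V, ∀ u v, fderiv ℝ θ p u v - fderiv ℝ θ p v u = bilin (Ω p) u v := by
  have hS := isOpen_slit hV
  obtain ⟨h, x₀, hx₀, hh, hhV, hh1, hh0⟩ := exists_smooth_contraction hV hc
  let H : ℝ × (E × E) → E × E := fun q => (h (q.1, q.2.1), q.2.2)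
  have hN : IsOpen ((univ : Set ℝ) ×ˢ slit V) := isOpen_univ.prod hS
  have hH : ContDiffOn ℝ ∞ H (univ ×ˢ slit V) := by
    refine ContDiffOn.prodMk (hh.comp (t := univ ×ˢ V)
      (f := fun q : ℝ × (E × E) => (q.1, q.2.1)) (ContDiff.contDiffOn (by fun_prop)) ?_)
      (ContDiff.contDiffOn (by fun_prop))
    exact fun q hq => ⟨mem_univ _, hq.2.1⟩
  have hHS : MapsTo H (univ ×ˢ slit V) (slit V) := fun q hq =>
    ⟨hhV ⟨mem_univ _, hq.2.1⟩, hq.2.2⟩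
  have hH0 : ∀ p ∈ slit V, ∀ u, fderiv ℝ H (0, p) (0, u) = (0, u.2) := by
    intro p hp u
    have h1 : DifferentiableAt ℝ H (0, p) :=
      (hH.contDiffAt (hN.mem_nhds ⟨mem_univ _, hp⟩)).differentiableAt (by simp)
    have h2 := h1.hasFDerivAt.comp p (hasFDerivAt_prodMk_right (0 : ℝ) p)
    have h3 : HasFDerivAt (fun q : E × E => (x₀, q.2))
        ((0 : E × E →L[ℝ] E).prod (.snd ℝ E E)) p :=
      (hasFDerivAt_const x₀ p).prodMk hasFDerivAt_snd
    have h4 := h2.unique (h3.congr_of_eventuallyEq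
      (Filter.mem_of_superset (hS.mem_nhds hp) fun q hq => Prod.ext (hh0 _ hq.1) rfl))
    exact DFunLike.congr_fun h4 u
  obtain ⟨K, hK, hdK⟩ := exists_primitive_of_homotopy hS hN (prod_mono (subset_univ _) subset_rfl)
    (contDiffOn_bilin hΩ) (fun p _ => bilin_swap _) (fun p hp u v w => by
      have h1 := hclosed p hp u v w
      rw [trilin_extDeriv] at h1
      have h2 : DifferentiableAt ℝ Ω p :=
        (hΩ.contDiffAt (hS.mem_nhds hp)).differentiableAt (by simp)
      rw [fderiv_bilin h2, fderiv_bilin h2, fderiv_bilin h2, h1]) hH hHS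
    (fun p hp => Prod.ext (hh1 _ hp.1) rfl) (fun p hp u v => by
      rw [hH0 p hp, hH0 p hp]
      exact hvert _ (hHS ⟨mem_univ _, hp⟩) _ _)
  obtain ⟨f, hf, hdf⟩ := exists_fibre_primitive hdim hV hK (fun p hp a b => by
    have h1 := hdK p hp (0, a) (0, b)
    rw [hvert p hp] at h1
    linarith)
  have hf' := hf.fderiv_of_isOpen (m := ∞) hS (by simp)
  refine ⟨fun p => K p - fderiv ℝ f p, hK.sub hf', fun p hp w => ?_, fun p hp u v => ?_⟩
  · rw [sub_apply, hdf p hp, sub_self]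
  · have h1 := ((hK.contDiffAt (hS.mem_nhds hp)).differentiableAt (by simp)).hasFDerivAt.sub
      (differentiableAt_fderiv_slit hV hf hp).hasFDerivAt
    have h2 : fderiv ℝ (fun p => K p - fderiv ℝ f p) p
        = fderiv ℝ K p - fderiv ℝ (fderiv ℝ f) p := h1.fderiv
    rw [h2]
    simp only [sub_apply]
    rw [← hdK p hp, isSymmSndFDerivAt_of_contDiffOn_slit hV hf hp u v]
    ring

/-- A horizontal primitive `θ` of a 2-form whose characteristic distribution is spanned by `Δ` and
the spray `Γ` is the Hilbert 1-form of the pseudo-Finsler function `θ(Γ)`, and the geodesics of `Γ`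
solve its Euler–Lagrange equations. -/
theorem exists_isPseudoFinsler_of_primitive {E : Type*} [NormedAddCommGroup E] [NormedSpace ℝ E]
    {V : Set E} (hV : IsOpen V) {Γ : E × E → E × E} (hΓ : IsSprayOn V Γ)
    {Ω : E × E → (E × E) [⋀^Fin 2]→L[ℝ] ℝ} {θ : E × E → E × E →L[ℝ] ℝ}
    (hθ : ContDiffOn ℝ ∞ θ (slit V)) (hθv : ∀ p ∈ slit V, ∀ w : E, θ p (0, w) = 0)
    (hdθ : ∀ p ∈ slit V, ∀ u v, fderiv ℝ θ p u v - fderiv ℝ θ p v u = bilin (Ω p) u v)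
    (hker : ∀ p ∈ slit V, characteristicDistribution Ω p = sprayDistribution Γ p) :
    ∃ F : E × E → ℝ, IsPseudoFinsler V F ∧ ∀ p ∈ slit V, ∀ a : E,
      fderiv ℝ (fderiv ℝ F) p (Γ p) (0, a) = fderiv ℝ F p (a, 0) := by
  have hS := isOpen_slit hV
  have hθd : ∀ p ∈ slit V, DifferentiableAt ℝ θ p := fun p hp =>
    (hθ.contDiffAt (hS.mem_nhds hp)).differentiableAt (by simp)
  have hθa : ∀ p ∈ slit V, ∀ v : E × E, HasFDerivAt (fun q => θ q v) ((fderiv ℝ θ p).flip v) p :=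
    fun p hp v => by
      simpa using (hθd p hp).hasFDerivAt.clm_apply (hasFDerivAt_const v p)
  have hdv : ∀ p ∈ slit V, ∀ (z : E × E) (w : E), fderiv ℝ θ p z (0, w) = 0 := by
    intro p hp z w
    have h1 := (hθa p hp (0, w)).unique ((hasFDerivAt_const (0 : ℝ) p).congr_of_eventuallyEq
      (Filter.mem_of_superset (hS.mem_nhds hp) fun q hq => hθv q hq w))
    exact DFunLike.congr_fun h1 z
  have hB : ∀ p ∈ slit V, ∀ w u : E,
      fderiv ℝ θ p (0, w) (u, 0) = bilin (Ω p) (0, w) (u, 0) := fun p hp w u => by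
    rw [← hdθ p hp, hdv p hp, sub_zero]
  have hBv : ∀ p ∈ slit V, ∀ a b : E, bilin (Ω p) (0, a) (0, b) = 0 := fun p hp a b => by
    rw [← hdθ p hp, hdv p hp, hdv p hp, sub_zero]
  have hiΓ : ∀ p ∈ slit V, ∀ v, bilin (Ω p) (Γ p) v = 0 := fun p hp =>
    mem_characteristicDistribution.1
      (hker p hp ▸ Submodule.subset_span (by simp))
  have hiΔ : ∀ p ∈ slit V, ∀ v, bilin (Ω p) (0, p.2) v = 0 := fun p hp =>
    mem_characteristicDistribution.1
      (hker p hp ▸ Submodule.subset_span (by simp) : Δ p ∈ characteristicDistribution Ω p)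
  have hΓsplit : ∀ p ∈ slit V, Γ p = (p.2, 0) + (0, (Γ p).2) := fun p hp => by
    rw [hΓ.eq_mk hp]
    simp
  have hBy : ∀ p ∈ slit V, ∀ w : E, bilin (Ω p) (0, w) (p.2, 0) = 0 := fun p hp w => by
    have h1 := hiΓ p hp (0, w)
    rw [hΓsplit p hp, map_add, add_apply, hBv p hp, add_zero] at h1
    rw [bilin_swap, h1, neg_zero]
  let F : E × E → ℝ := fun p => θ p (p.2, 0)
  have hF : ContDiffOn ℝ ∞ F (slit V) :=
    hθ.clm_apply (ContDiff.contDiffOn (by fun_prop))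
  have hdF : ∀ p ∈ slit V, ∀ u w : E,
      fderiv ℝ F p (u, w) = fderiv ℝ θ p (u, w) (p.2, 0) + θ p (w, 0) := by
    intro p hp u w
    have h1 : HasFDerivAt (fun q : E × E => ((q.2, 0) : E × E))
        ((ContinuousLinearMap.snd ℝ E E).prod 0) p :=
      hasFDerivAt_snd.prodMk (hasFDerivAt_const (0 : E) p)
    have h2 := (hθd p hp).hasFDerivAt.clm_apply h1
    refine (DFunLike.congr_fun h2.fderiv (u, w)).trans ?_
    simp [add_comm]
  have hFy : ∀ p ∈ slit V, ∀ w : E, fderiv ℝ F p (0, w) = θ p (w, 0) := fun p hp w => by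
    rw [hdF p hp, hB p hp, hBy p hp, zero_add]
  have hFyd : ∀ p ∈ slit V, ∀ (z : E × E) (v : E),
      fderiv ℝ (fun q => fderiv ℝ F q (0, v)) p z = fderiv ℝ θ p z (v, 0) := by
    intro p hp z v
    exact DFunLike.congr_fun ((hθa p hp (v, 0)).congr_of_eventuallyEq
      (Filter.mem_of_superset (hS.mem_nhds hp) fun q hq => hFy q hq v)).fderiv z
  have hHess : ∀ p ∈ slit V, ∀ u v : E, fibreHessian F p u v = bilin (Ω p) (0, u) (v, 0) :=
    fun p hp u v => (hFyd p hp _ _).trans (hB p hp u v)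
  have hsymm : ∀ p ∈ slit V, ∀ u v : E,
      bilin (Ω p) (0, u) (v, 0) = bilin (Ω p) (0, v) (u, 0) := fun p hp u v => by
    rw [← hHess p hp, ← hHess p hp, fibreHessian_eq hV hF hp, fibreHessian_eq hV hF hp,
      isSymmSndFDerivAt_of_contDiffOn_slit hV hF hp]
  refine ⟨F, ⟨hF, fun p hp r hr => ?_, fun p hp v => ⟨fun h => ?_, ?_⟩⟩, fun p hp a => ?_⟩
  · have h1 := homogeneous_of_euler (G := θ) 0 hθd (fun q hq => by
      refine ContinuousLinearMap.ext ?_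
      rintro ⟨u, w⟩
      have h2 : ((u, w) : E × E) = (u, 0) + (0, w) := by simp
      rw [h2, map_add, hdv q hq, hB q hq, hiΔ q hq]
      simp) hp hr
    have h2 : ((r • p.2, 0) : E × E) = r • (p.2, 0) := by simp
    simp only [F]
    rw [h1, h2, map_smul, pow_zero, one_smul, smul_eq_mul]
  · have h1 : ((0, v) : E × E) ∈ sprayDistribution Γ p := by
      rw [← hker p hp, mem_characteristicDistribution]
      rintro ⟨u, w⟩
      have h2 : ((u, w) : E × E) = (u, 0) + (0, w) := by simp
      rw [h2, map_add, hBv p hp, add_zero, hsymm p hp, ← hHess p hp]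
      exact h u
    obtain ⟨a, b, hab⟩ := mem_sprayDistribution.1 h1
    rw [hΓ.eq_mk hp, Δ] at hab
    have h3 := congrArg Prod.fst hab
    have h4 := congrArg Prod.snd hab
    simp only [Prod.smul_mk, Prod.mk_add_mk, smul_zero, zero_add, smul_eq_zero] at h3 h4
    have hb : b = 0 := h3.resolve_right hp.2
    refine ⟨a, ?_⟩
    rw [← h4, hb, zero_smul, add_zero]
  · rintro ⟨k, rfl⟩ u
    have h1 : ((0, k • p.2) : E × E) = k • (0, p.2) := by simp
    rw [hHess p hp, hsymm p hp, h1, map_smul, smul_apply, hiΔ p hp, smul_zero]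
  · have h1 := ((differentiableAt_fderiv_slit hV hF hp).hasFDerivAt.clm_apply
      (hasFDerivAt_const ((0, a) : E × E) p)).fderiv
    have h2 : fderiv ℝ (fderiv ℝ F) p (Γ p) (0, a)
        = fderiv ℝ (fun q => fderiv ℝ F q (0, a)) p (Γ p) := by
      rw [h1]
      simp
    have h3 := hdθ p hp (Γ p) (a, 0)
    have h4 : fderiv ℝ θ p (a, 0) (Γ p) = fderiv ℝ θ p (a, 0) (p.2, 0) := by
      rw [hΓsplit p hp, map_add, hdv p hp, add_zero]
    have h5 : θ p (0, 0) = 0 := map_zero _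
    rw [h2, hFyd p hp, hdF p hp, h5, add_zero]
    rw [hiΓ p hp, h4] at h3
    linarith

end Reconstruction

/-! ### Reparametrization of geodesics -/

section Reparametrization

theorem exists_antiderivative {J : Set ℝ} (hJ : IsOpen J) (hJc : J.OrdConnected) {μ : ℝ → ℝ}
    (hμ : ContDiffOn ℝ ∞ μ J) :
    ∃ A : ℝ → ℝ, ContDiffOn ℝ ∞ A J ∧ ∀ t ∈ J, HasDerivAt A (μ t) t := by
  rcases J.eq_empty_or_nonempty with rfl | ⟨t₀, ht₀⟩
  · exact ⟨0, contDiffOn_const, by simp⟩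
  have hA : ∀ t ∈ J, HasDerivAt (fun t => ∫ s in t₀..t, μ s) (μ t) t := fun t ht =>
    intervalIntegral.integral_hasDerivAt_right
      (hμ.continuousOn.mono (hJc.uIcc_subset ht₀ ht)).intervalIntegrable
      (hμ.continuousOn.stronglyMeasurableAtFilter hJ t ht)
      (hμ.continuousOn.continuousAt (hJ.mem_nhds ht))
  refine ⟨_, (contDiffOn_infty_iff_deriv_of_isOpen hJ).2
    ⟨fun t ht => (hA t ht).differentiableAt.differentiableWithinAt, ?_⟩, hA⟩
  exact hμ.congr fun t ht => (hA t ht).deriv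

/-- A smooth function with positive derivative on an open interval has a smooth inverse. -/
theorem exists_smooth_inverse {J : Set ℝ} (hJ : IsOpen J) (hJc : J.OrdConnected) {ρ ρ' : ℝ → ℝ}
    (hρ : ContDiffOn ℝ ∞ ρ J) (hρ' : ∀ t ∈ J, HasDerivAt ρ (ρ' t) t) (hpos : ∀ t ∈ J, 0 < ρ' t) :
    ∃ (σ : ℝ → ℝ) (J' : Set ℝ), IsOpen J' ∧ J'.OrdConnected ∧ BijOn σ J' J ∧
      ContDiffOn ℝ ∞ σ J' ∧ ∀ s ∈ J', HasDerivAt σ (ρ' (σ s))⁻¹ s := by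
  have hmono : StrictMonoOn ρ J := strictMonoOn_of_deriv_pos hJc.convex hρ.continuousOn (by
    rw [hJ.interior_eq]
    intro t ht
    rw [(hρ' t ht).deriv]
    exact hpos t ht)
  have hbij : BijOn ρ J (ρ '' J) := hmono.injOn.bijOn_image
  have hinv : InvOn (Function.invFunOn ρ J) ρ J (ρ '' J) := hbij.invOn_invFunOn
  have hσ : BijOn (Function.invFunOn ρ J) (ρ '' J) J := hinv.symm.bijOn
    hbij.surjOn.mapsTo_invFunOn hbij.mapsTo
  set σ := Function.invFunOn ρ J
  -- Near each point `σ` agrees with the local inverse of the inverse function theorem.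
  have hloc : ∀ t ∈ J, ρ '' J ∈ 𝓝 (ρ t) ∧ ContDiffAt ℝ ∞ σ (ρ t) := by
    intro t ht
    have hc : ContDiffAt ℝ ∞ ρ t := hρ.contDiffAt (hJ.mem_nhds ht)
    have hd : HasFDerivAt ρ ((ContinuousLinearEquiv.unitsEquivAut ℝ
        (Units.mk0 (ρ' t) (hpos t ht).ne') : ℝ ≃L[ℝ] ℝ) : ℝ →L[ℝ] ℝ) t := by
      refine (hρ' t ht).hasFDerivAt.congr_fderiv ?_
      ext
      simp
    have hs := hc.hasStrictFDerivAt' hd (by simp)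
    have hr := hs.eventually_right_inverse
    have hgt : hs.localInverse ρ _ t (ρ t) = t := hs.localInverse_apply_image
    have hgJ : ∀ᶠ s in 𝓝 (ρ t), hs.localInverse ρ _ t s ∈ J :=
      hs.localInverse_continuousAt.eventually (by rw [hgt]; exact hJ.mem_nhds ht)
    refine ⟨?_, ?_⟩
    · filter_upwards [hr, hgJ] with s h1 h2
      exact ⟨_, h2, h1⟩
    · refine (hc.to_localInverse hd (by simp)).congr_of_eventuallyEq ?_
      filter_upwards [hr, hgJ] with s h1 h2
      change σ s = hs.localInverse ρ _ t s
      conv_lhs => rw [← h1]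
      exact hinv.1 h2
  have hopen : IsOpen (ρ '' J) := isOpen_iff_mem_nhds.2 (by
    rintro _ ⟨t, ht, rfl⟩
    exact (hloc t ht).1)
  refine ⟨σ, ρ '' J, hopen, (hJc.isPreconnected.image ρ hρ.continuousOn).ordConnected, hσ, ?_, ?_⟩
  · rintro _ ⟨t, ht, rfl⟩
    exact (hloc t ht).2.contDiffWithinAt
  · intro s hs
    have h1 : DifferentiableAt ℝ σ s := by
      obtain ⟨t, ht, rfl⟩ := hs
      exact (hloc t ht).2.differentiableAt (by simp)
    have h2 := (hρ' (σ s) (hσ.mapsTo hs)).comp s h1.hasDerivAt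
    have h3 := h2.unique ((hasDerivAt_id' s).congr_of_eventuallyEq
      (Filter.mem_of_superset (hopen.mem_nhds hs) fun r hr => hinv.2 hr))
    rw [← eq_inv_of_mul_eq_one_right h3]
    exact h1.hasDerivAt

theorem IsSprayOn.contDiffOn_integralCurve {E : Type*} [NormedAddCommGroup E] [NormedSpace ℝ E]
    {V : Set E} {Γ : E × E → E × E} (hΓ : IsSprayOn V Γ) {γ : ℝ → E × E} {J : Set ℝ}
    (hJ : IsOpen J) (hγ : ∀ t ∈ J, γ t ∈ slit V ∧ HasDerivAt γ (Γ (γ t)) t) :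
    ContDiffOn ℝ ∞ γ J := by
  rw [contDiffOn_infty]
  intro k
  induction k with
  | zero =>
    exact contDiffOn_zero.2 fun t ht => (hγ t ht).2.continuousAt.continuousWithinAt
  | succ k ih =>
    push_cast
    rw [contDiffOn_succ_iff_deriv_of_isOpen hJ]
    refine ⟨fun t ht => (hγ t ht).2.differentiableAt.differentiableWithinAt, by simp, ?_⟩
    have h1 : ContDiffOn ℝ k (Γ ∘ γ) J :=
      (contDiffOn_infty.1 hΓ.smooth k).comp ih fun t ht => (hγ t ht).1
    exact h1.congr fun t ht => (hγ t ht).2.deriv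

/-- The geodesics of a spray `Γ` become those of `Γ' = Γ + λ Δ` after an orientation-preserving
reparametrization: the inverse `ρ` of the change of parameter has derivative `exp (-∫ λ)`. -/
theorem geodesicsReparametrize_of_smul {E : Type*} [NormedAddCommGroup E] [InnerProductSpace ℝ E]
    {V : Set E} (hV : IsOpen V) {Γ Γ' : E × E → E × E} (hΓ : IsSprayOn V Γ)
    (hΓ' : IsSprayOn V Γ')
    (h : ∀ p ∈ slit V, ∃ k : ℝ, (Γ' p).2 - (Γ p).2 = k • p.2) :
    GeodesicsReparametrize V Γ Γ' := by
  -- The factor `λ`, written as an inner product so as to be visibly smooth.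
  let l : E × E → ℝ := fun p => inner ℝ p.2 ((Γ' p).2 - (Γ p).2) / ‖p.2‖ ^ 2
  have hl : ContDiffOn ℝ ∞ l (slit V) :=
    (contDiffOn_snd.inner ℝ (hΓ'.smooth.snd.sub hΓ.smooth.snd)).div
      (contDiffOn_snd.norm_sq ℝ) fun p hp => by simpa using hp.2
  have hleq : ∀ p ∈ slit V, (Γ' p).2 = (Γ p).2 + l p • p.2 := by
    intro p hp
    obtain ⟨k, hk⟩ := h p hp
    have h1 : l p = k := by
      simp only [l]
      rw [hk, real_inner_smul_right, real_inner_self_eq_norm_sq,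
        mul_div_cancel_right₀ _ (pow_ne_zero 2 (norm_ne_zero_iff.2 hp.2))]
    rw [h1, ← hk, add_sub_cancel]
  rintro c J ⟨hJ, hJc, γ, hγ⟩
  have hγsm := hΓ.contDiffOn_integralCurve hJ fun t ht => ⟨(hγ t ht).1, (hγ t ht).2.1⟩
  obtain ⟨A, hA, hA'⟩ := exists_antiderivative hJ hJc (hl.comp hγsm fun t ht => (hγ t ht).1)
  obtain ⟨ρ, hρ, hρ'⟩ := exists_antiderivative hJ hJc hA.neg.exp
  obtain ⟨σ, J', hJ', hJc', hσ, hσsm, hσ'⟩ :=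
    exists_smooth_inverse hJ hJc hρ hρ' fun t _ => Real.exp_pos _
  have hσe : ∀ s ∈ J', HasDerivAt σ (Real.exp (A (σ s))) s := fun s hs => by
    have h1 := hσ' s hs
    rwa [← Real.exp_neg, neg_neg] at h1
  refine ⟨σ, J', hσ, hσsm, fun s hs => ?_, hJ', hJc',
    fun s => ((γ (σ s)).1, Real.exp (A (σ s)) • (γ (σ s)).2), fun s hs => ?_⟩
  · rw [(hσe s hs).deriv]
    exact Real.exp_pos _
  · have ht := hσ.mapsTo hs
    obtain ⟨h1, h2, h3⟩ := hγ _ ht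
    have he := Real.exp_pos (A (σ s))
    refine ⟨slit_smul h1 he, ?_, h3⟩
    have h4 := h2.scomp s (hσe s hs)
    have h5 : HasDerivAt (fun s => (γ (σ s)).1) (Real.exp (A (σ s)) • (Γ (γ (σ s))).1) s :=
      (h4.hasFDerivAt.fst.hasDerivAt).congr_deriv (by simp)
    have h6 : HasDerivAt (fun s => (γ (σ s)).2) (Real.exp (A (σ s)) • (Γ (γ (σ s))).2) s :=
      (h4.hasFDerivAt.snd.hasDerivAt).congr_deriv (by simp)
    have h7 : HasDerivAt (fun s => Real.exp (A (σ s)))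
        (Real.exp (A (σ s)) * (l (γ (σ s)) * Real.exp (A (σ s)))) s :=
      ((hA' _ ht).comp s (hσe s hs)).exp
    refine (h5.prodMk (h7.smul h6)).congr_deriv ?_
    rw [hΓ.second_order _ h1]
    refine Prod.ext ?_ ?_
    · exact (hΓ'.second_order _ (slit_smul h1 he)).symm
    · rw [hΓ'.snd_smul hV h1 he, hleq _ h1]
      module

/-- The derivative of a positively homogeneous function of degree 1. -/
theorem IsPseudoFinsler.fderiv_smul {E : Type*} [NormedAddCommGroup E] [NormedSpace ℝ E]
    {V : Set E} {F : E × E → ℝ} (hF : IsPseudoFinsler V F) (hV : IsOpen V) {p : E × E}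
    (hp : p ∈ slit V) {r : ℝ} (hr : 0 < r) (u w : E) :
    fderiv ℝ F (p.1, r • p.2) (u, r • w) = r * fderiv ℝ F p (u, w) := by
  have hd : ∀ q ∈ slit V, DifferentiableAt ℝ F q := fun q hq =>
    (hF.smooth.contDiffAt ((isOpen_slit hV).mem_nhds hq)).differentiableAt (by simp)
  have h1 : HasFDerivAt (fun q : E × E => ((q.1, r • q.2) : E × E))
      ((ContinuousLinearMap.fst ℝ E E).prod (r • ContinuousLinearMap.snd ℝ E E)) p :=
    hasFDerivAt_fst.prodMk (hasFDerivAt_snd.const_smul r)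
  have h2 := (hd _ (slit_smul hp hr)).hasFDerivAt.comp p h1
  have h3 := h2.unique (((hd p hp).hasFDerivAt.const_mul r).congr_of_eventuallyEq
    (Filter.mem_of_superset ((isOpen_slit hV).mem_nhds hp) fun q hq => hF.homogeneous q hq r hr))
  exact DFunLike.congr_fun h3 (u, w)

/-- The Euler–Lagrange equations of a pseudo-Finsler function are invariant under
orientation-preserving reparametrization. -/
theorem IsPseudoFinsler.solvesEulerLagrange_of_reparametrize {E : Type*} [NormedAddCommGroup E]
    [NormedSpace ℝ E] {V : Set E} {F : E × E → ℝ} (hF : IsPseudoFinsler V F) (hV : IsOpen V)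
    {Γ Γ' : E × E → E × E} (hΓ' : IsSprayOn V Γ') (hr : GeodesicsReparametrize V Γ' Γ)
    (hEL : ∀ (c : ℝ → E) (J : Set ℝ), IsGeodesicOn V Γ c J → SolvesEulerLagrange F c J)
    {c : ℝ → E} {J : Set ℝ} (hc : IsGeodesicOn V Γ' c J) : SolvesEulerLagrange F c J := by
  obtain ⟨σ, J', hσ, hσsm, hσpos, hgeo⟩ := hr c J hc
  obtain ⟨hJ, -, γ, hγ⟩ := hc
  have hJ' : IsOpen J' := hgeo.1
  have hEL' := hEL _ _ hgeo
  have hσd : ∀ s ∈ J', HasDerivAt σ (deriv σ s) s := fun s hs =>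
    ((hσsm.contDiffAt (hJ'.mem_nhds hs)).differentiableAt (by simp)).hasDerivAt
  have hcd : ∀ t ∈ J, HasDerivAt c (γ t).2 t := fun t ht => hΓ'.hasDerivAt_geodesic hJ hγ ht
  have hlift : ∀ t ∈ J, (c t, deriv c t) = γ t := fun t ht =>
    Prod.ext (hγ t ht).2.2.symm (hcd t ht).deriv
  have hlift' : ∀ s ∈ J', ((c ∘ σ) s, deriv (c ∘ σ) s)
      = ((γ (σ s)).1, deriv σ s • (γ (σ s)).2) := fun s hs =>
    Prod.ext (hγ _ (hσ.mapsTo hs)).2.2.symm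
      ((hcd _ (hσ.mapsTo hs)).scomp s (hσd s hs)).deriv
  intro t ht a
  obtain ⟨s, hs, rfl⟩ := hσ.surjOn ht
  have h1 : HasDerivAt (fun t => fderiv ℝ F (c t, deriv c t) (0, a)) _ (σ s) :=
    (hasDerivAt_fderiv_comp hV hF.smooth (hγ _ ht).1 (hγ _ ht).2.1
      ((0, a) : E × E)).congr_of_eventuallyEq
      (Filter.mem_of_superset (hJ.mem_nhds ht) fun r hr => by
        change fderiv ℝ F (c r, deriv c r) (0, a) = fderiv ℝ F (γ r) (0, a)
        rw [hlift r hr])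
  have h2 := h1.comp s (hσd s hs)
  have h3 := (hEL' s hs a).congr_of_eventuallyEq (f₁ := fun s =>
      fderiv ℝ F (c (σ s), deriv c (σ s)) (0, a)) (Filter.mem_of_superset (hJ'.mem_nhds hs)
      fun r hr => by
        change fderiv ℝ F (c (σ r), deriv c (σ r)) (0, a)
          = fderiv ℝ F ((c ∘ σ) r, deriv (c ∘ σ) r) (0, a)
        have hpos := hσpos r hr
        rw [hlift' r hr, hlift _ (hσ.mapsTo hr)]
        have h4 := hF.fderiv_smul hV (hγ _ (hσ.mapsTo hr)).1 hpos 0 ((deriv σ r)⁻¹ • a)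
        rw [smul_smul, mul_inv_cancel₀ hpos.ne', one_smul] at h4
        have h5 : ((0, (deriv σ r)⁻¹ • a) : E × E) = (deriv σ r)⁻¹ • (0, a) := by simp
        rw [h4, h5, map_smul, smul_eq_mul, ← mul_assoc, mul_inv_cancel₀ hpos.ne', one_mul])
  have h4 := h2.unique h3
  have h5 := hF.fderiv_smul hV (hγ _ ht).1 (hσpos s hs) a 0
  rw [smul_zero] at h5
  rw [hlift' s hs, h5, mul_comm] at h4
  rw [hlift _ ht, ← mul_left_cancel₀ (hσpos s hs).ne' h4]
  exact h1

theorem GeodesicsReparametrize.trans {E : Type*} [NormedAddCommGroup E] [NormedSpace ℝ E]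
    {V : Set E} {Γ Γ' Γ'' : E × E → E × E} (h : GeodesicsReparametrize V Γ Γ')
    (h' : GeodesicsReparametrize V Γ' Γ'') : GeodesicsReparametrize V Γ Γ'' := by
  intro c J hc
  obtain ⟨σ, J', hσ, hσs, hσp, hg⟩ := h c J hc
  obtain ⟨τ, J'', hτ, hτs, hτp, hg'⟩ := h' _ _ hg
  refine ⟨σ ∘ τ, J'', hσ.comp hτ, hσs.comp hτs hτ.mapsTo, fun s hs => ?_, hg'⟩
  have h1 := (hσs.contDiffAt (hg.1.mem_nhds (hτ.mapsTo hs))).differentiableAt (by simp)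
  have h2 := (hτs.contDiffAt (hg'.1.mem_nhds hs)).differentiableAt (by simp)
  rw [deriv_comp s h1 h2]
  exact mul_pos (hσp _ (hτ.mapsTo hs)) (hτp s hs)

theorem ProjectivelyEquivalent.symm {E : Type*} [NormedAddCommGroup E] [NormedSpace ℝ E]
    {V : Set E} {Γ Γ' : E × E → E × E} (h : ProjectivelyEquivalent V Γ Γ') :
    ProjectivelyEquivalent V Γ' Γ :=
  ⟨h.2, h.1⟩

theorem ProjectivelyEquivalent.trans {E : Type*} [NormedAddCommGroup E] [NormedSpace ℝ E]
    {V : Set E} {Γ Γ' Γ'' : E × E → E × E} (h : ProjectivelyEquivalent V Γ Γ')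
    (h' : ProjectivelyEquivalent V Γ' Γ'') : ProjectivelyEquivalent V Γ Γ'' :=
  ⟨h.1.trans h'.1, h'.2.trans h.2⟩

theorem projectiveClass_eq_of_mem {E : Type*} [NormedAddCommGroup E] [NormedSpace ℝ E]
    {V : Set E} {Γ Γ' : E × E → E × E} (h : Γ' ∈ projectiveClass V Γ) :
    projectiveClass V Γ' = projectiveClass V Γ :=
  Set.ext fun _ => and_congr_right fun _ =>
    ⟨fun h' => h.2.trans h', fun h' => h.2.symm.trans h'⟩

/-- The geodesic class of a pseudo-Finsler function is the projective class of any of its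
members. -/
theorem IsPseudoFinsler.geodesicClass_eq {E : Type*} [NormedAddCommGroup E]
    [InnerProductSpace ℝ E] [CompleteSpace E] {V : Set E} {F : E × E → ℝ}
    (hF : IsPseudoFinsler V F) (hV : IsOpen V) {Γ : E × E → E × E}
    (hΓ : Γ ∈ geodesicClass V F) : geodesicClass V F = projectiveClass V Γ := by
  ext Γ'
  refine ⟨fun hΓ' => ⟨hΓ'.1, ?_, ?_⟩, fun hΓ' => ⟨hΓ'.1, fun c J hc =>
    hF.solvesEulerLagrange_of_reparametrize hV hΓ'.1 hΓ'.2.2 hΓ.2 hc⟩⟩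
  · exact geodesicsReparametrize_of_smul hV hΓ.1 hΓ'.1 fun p hp =>
      hF.exists_smul_of_eulerLagrange hV hΓ.1 hΓ'.1 hp
        ((hΓ.1.forall_solvesEulerLagrange_iff hV hF.smooth).1 hΓ.2 p hp)
        ((hΓ'.1.forall_solvesEulerLagrange_iff hV hF.smooth).1 hΓ'.2 p hp)
  · exact geodesicsReparametrize_of_smul hV hΓ'.1 hΓ.1 fun p hp =>
      hF.exists_smul_of_eulerLagrange hV hΓ'.1 hΓ.1 hp
        ((hΓ'.1.forall_solvesEulerLagrange_iff hV hF.smooth).1 hΓ'.2 p hp)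
        ((hΓ.1.forall_solvesEulerLagrange_iff hV hF.smooth).1 hΓ.2 p hp)

end Reparametrization

end SprayGeometry

end

theorem mainTheorem6 (n : ℕ) (hn : 3 ≤ n)
    {M : Type*} [TopologicalSpace M] [ChartedSpace (EuclideanSpace ℝ (Fin n)) M]
    [IsManifold (𝓡 n) ∞ M]
    (Γ₀ : (p : TangentBundle (𝓡 n) M) → TangentSpace (𝓡 n).tangent p)
    (hΓ₀ : SprayGeometry.IsSpray Γ₀)
    (φ : OpenPartialHomeomorph M (EuclideanSpace ℝ (Fin n)))
    (hφ : φ ∈ IsManifold.maximalAtlas (𝓡 n) ∞ M)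
    (P : Set (EuclideanSpace ℝ (Fin n) × EuclideanSpace ℝ (Fin n) →
      EuclideanSpace ℝ (Fin n) × EuclideanSpace ℝ (Fin n)))
    (hP : P = SprayGeometry.projectiveClass φ.target (SprayGeometry.localExpression φ Γ₀)) :
    ((∃ F : EuclideanSpace ℝ (Fin n) × EuclideanSpace ℝ (Fin n) → ℝ,
        SprayGeometry.IsPseudoFinsler φ.target F ∧
          SprayGeometry.geodesicClass φ.target F = P) →
      ∃ Ω : EuclideanSpace ℝ (Fin n) × EuclideanSpace ℝ (Fin n) →
          (EuclideanSpace ℝ (Fin n) × EuclideanSpace ℝ (Fin n)) [⋀^Fin 2]→L[ℝ] ℝ,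
        ∀ Γ ∈ P, SprayGeometry.HasHilbertProperties φ.target Γ Ω ∧
          ∀ p ∈ SprayGeometry.slit φ.target,
            SprayGeometry.characteristicDistribution Ω p =
              SprayGeometry.sprayDistribution Γ p) ∧
    (ContractibleSpace φ.source →
      (∃ Ω : EuclideanSpace ℝ (Fin n) × EuclideanSpace ℝ (Fin n) →
          (EuclideanSpace ℝ (Fin n) × EuclideanSpace ℝ (Fin n)) [⋀^Fin 2]→L[ℝ] ℝ,
        ∃ Γ ∈ P, SprayGeometry.HasHilbertProperties φ.target Γ Ω ∧
          ∀ p ∈ SprayGeometry.slit φ.target,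
            SprayGeometry.characteristicDistribution Ω p =
              SprayGeometry.sprayDistribution Γ p) →
      ∃ F : EuclideanSpace ℝ (Fin n) × EuclideanSpace ℝ (Fin n) → ℝ,
        SprayGeometry.IsPseudoFinsler φ.target F ∧
          SprayGeometry.geodesicClass φ.target F = P) := by
  have hV := φ.open_target
  constructor
  · rintro ⟨F, hF, rfl⟩
    exact ⟨SprayGeometry.hilbertTwoForm F, fun Γ hΓ => hF.hasHilbertProperties hV hΓ.1
      ((hΓ.1.forall_solvesEulerLagrange_iff hV hF.smooth).1 hΓ.2)⟩
  · rintro hc ⟨Ω, Γ, hΓP, hΩ, hker⟩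
    have hΓ : SprayGeometry.IsSprayOn φ.target Γ := by
      rw [hP] at hΓP
      exact hΓP.1
    have hc' : ContractibleSpace φ.target := φ.toHomeomorphSourceTarget.symm.contractibleSpace
    have hdim : 2 < Module.finrank ℝ (EuclideanSpace ℝ (Fin n)) := by
      rw [finrank_euclideanSpace_fin]
      omega
    obtain ⟨θ, hθ, hθv, hdθ⟩ := SprayGeometry.exists_horizontal_primitive hdim hV hc' hΩ.smooth
      (fun p hp => hΩ.trilin_extDeriv_eq_zero hV hΓ hp)
      (fun p hp a b => (SprayGeometry.bilin_apply _ _ _).trans (hΩ.vertical p hp a b))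
    obtain ⟨F, hF, hEL⟩ :=
      SprayGeometry.exists_isPseudoFinsler_of_primitive hV hΓ hθ hθv hdθ hker
    refine ⟨F, hF, ?_⟩
    rw [hP] at hΓP ⊢
    rw [hF.geodesicClass_eq hV ⟨hΓ, (hΓ.forall_solvesEulerLagrange_iff hV hF.smooth).2 hEL⟩,
      SprayGeometry.projectiveClass_eq_of_mem hΓP]
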